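/- Let $1<r<R$, $I=[-1,1]$, $D_s=\{z\in\mathbb C:|z|<s\}$, and let $T\colon I\to I$ be an analytic full branch map: $I=\bigcup_{i=1}^d I_i$ for closed intervals $I_i$ with disjoint interiors, $T|_{\operatorname{int} I_i}$ is an analytic diffeomorphism onto its image and $\overline{T(I_i)}=I$ for each $i$. Assume that each inverse branch $\varphi_i\colon I\to I_i$ extends to a holomorphic function on $D_R$ with $\varphi_i(D_R)\subseteq D_r$. Let $(\mathcal L f)(z)=\sum_{i=1}^d\sigma_i\varphi_i'(z)f(\varphi_i(z))$ with $\sigma_i=\operatorname{sgn}\varphi_i'(0)$. For $\rho\in(r,R)$ put $e_n(z)=(z/\rho)^n$ and let $(f,g)=\lim_{s\uparrow\rho}\frac1{2\pi}\int_0^{2\pi}f(se^{it})\overline{g(se^{it})}\,dt$ be the inner product of the Hardy space $H^2(D_\rho)$. For $N\in\mathbb N_0$ let $\hat H_N,\hat G_N$ be the $N\times N$ matrices $$(\hat H_N)_{kl}=\tfrac12\int_{-1}^1x^kx^l\,dx,\qquad(\hat G_N)_{kl}=\tfrac12\int_{-1}^1T(x)^kx^l\,dx\qquad(0\le k,l<N),$$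 let $H_N^\dagger$, $G_N$, $V_N$, $V_N^{-1}$ be the operators on $\ell^2(\mathbb N_0)$ which act on the first $N$ coordinates as the matrices $\hat H_N^{-1}$, $\hat G_N$, $\operatorname{diag}(\rho^k)_{k<N}$, $\operatorname{diag}(\rho^{-k})_{k<N}$ respectively, and which vanish on, and have range orthogonal to, the other unit vectors. Write $\gamma=(1+\sqrt2)^2$. Then: (i) every $\hat H_N$ is invertible; (ii) for every $\rho\in(r,R)$ the matrix $L_{kl}=(\mathcal L e_l,e_k)$ defines a bounded operator $L$ on $\ell^2(\mathbb N_0)$, and there is $C>0$, independent of $N$, with $$\|V_NH_N^\dagger G_NV_N^{-1}-L\|_{\ell^2}\le C\left(\Big(\frac{\gamma\rho}R\Big)^N+\Big(\frac r\rho\Big)^N\right)\qquad\text{for all }N\in\mathbb N_0;$$ (iii) for every $N\in\mathbb N_0$ the expression $(\gamma\rho/R)^N+(r/\rho)^N$, $\rho>0$, is minimal at $\rho=\sqrt{rR/\gamma}$, where it equals $2(\gamma r/R)^{N/2}$; (iv) if $r/R<1/\gamma$, then $\rho=\sqrt{rR/\gamma}$ lies in $(r,R)$, and for this $\rho$ there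 is $C>0$, independent of $N$, with $\|V_NH_N^\dagger G_NV_N^{-1}-L\|_{\ell^2}\le C(\gamma r/R)^{N/2}$ for all $N\in\mathbb N_0$. -/

import Mathlib

noncomputable section

namespace EDMD

/-- `T` is an analytic full branch map on `I = [-1,1]` with branch intervals
`I_i = [a i, b i]`: these closed intervals have disjoint interiors and union `I`, and on the
interior of each of them `T` is an analytic diffeomorphism onto its image, with `T(I_i)` dense
in `I`.  (The values of `T` at the endpoints of the branch intervals are unrestricted in `I`.) -/
structure IsAnalyticFullBranchMap {d : ℕ} (T : ℝ → ℝ) (a b : Fin d → ℝ) : Prop where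
  mapsTo : Set.MapsTo T (Set.Icc (-1) 1) (Set.Icc (-1) 1)
  lt : ∀ i, a i < b i
  iUnion_eq : ⋃ i, Set.Icc (a i) (b i) = Set.Icc (-1) 1
  disjoint : Pairwise fun i j => Disjoint (Set.Ioo (a i) (b i)) (Set.Ioo (a j) (b j))
  analytic : ∀ i, AnalyticOnNhd ℝ T (Set.Ioo (a i) (b i))
  injOn : ∀ i, Set.InjOn T (Set.Ioo (a i) (b i))
  deriv_ne_zero : ∀ i, ∀ x ∈ Set.Ioo (a i) (b i), deriv T x ≠ 0
  full : ∀ i, closure (T '' Set.Icc (a i) (b i)) = Set.Icc (-1) 1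

/-- The inverse branches of `T` extend to holomorphic functions `φ i` on the disk `D_R`, mapping
`D_R` into `D_r` (in particular they are bounded, i.e. lie in `H^∞(D_R)`). -/
structure HasHolomorphicInverseBranches {d : ℕ} (T : ℝ → ℝ) (a b : Fin d → ℝ)
    (φ : Fin d → ℂ → ℂ) (r R : ℝ) : Prop where
  differentiableOn : ∀ i, DifferentiableOn ℂ (φ i) (Metric.ball 0 R)
  mapsTo : ∀ i, Set.MapsTo (φ i) (Metric.ball 0 R) (Metric.ball 0 r)
  left_inv : ∀ i, ∀ x ∈ Set.Ioo (a i) (b i), φ i (T x : ℂ) = (x : ℂ)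

/-- The transfer operator `(ℒ f)(z) = ∑ i, σ_i φ_i'(z) f(φ_i(z))` with `σ_i = sgn (φ_i'(0))`
(the number `φ_i'(0)` is real). -/
def transfer {d : ℕ} (φ : Fin d → ℂ → ℂ) (f : ℂ → ℂ) (z : ℂ) : ℂ :=
  ∑ i, (Real.sign (deriv (φ i) 0).re : ℂ) * deriv (φ i) z * f (φ i z)

/-- The standard orthonormal basis `e_n(z) = (z/ρ)^n` of `H²(D_ρ)`. -/
def hardyBasis (ρ : ℝ) (n : ℕ) (z : ℂ) : ℂ := (z / (ρ : ℂ)) ^ n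

/-- `c` is the inner product of `f` and `g` in the Hardy-Hilbert space `H²(D_ρ)`, i.e.
`c = lim_{s ↑ ρ} (1/2π) ∫_0^{2π} f(s e^{it}) conj(g(s e^{it})) dt`. -/
def HasHardyInner (ρ : ℝ) (f g : ℂ → ℂ) (c : ℂ) : Prop :=
  Filter.Tendsto
    (fun s : ℝ => (1 / (2 * (Real.pi : ℂ))) * ∫ t in (0 : ℝ)..(2 * Real.pi),
      f ((s : ℂ) * Complex.exp (Complex.I * t)) *
        (starRingEnd ℂ) (g ((s : ℂ) * Complex.exp (Complex.I * t))))
    (nhdsWithin ρ (Set.Iio ρ)) (nhds c)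

/-- The complex sequence space `ℓ²(ℕ₀)`. -/
abbrev Ell2 : Type := lp (fun _ : ℕ => ℂ) 2

/-- The canonical unit vectors of `ℓ²(ℕ₀)`. -/
def unit (n : ℕ) : Ell2 := lp.single 2 n (1 : ℂ)

/-- `L` is the bounded operator on `ℓ²(ℕ₀)` whose matrix is that of the transfer operator on
`H²(D_ρ)` in the basis `(e_n)`: `L_{kl} = (ℒ e_l, e_k)`. Such an `L` is unique. -/
def IsTransferMatrix {d : ℕ} (φ : Fin d → ℂ → ℂ) (ρ : ℝ) (L : Ell2 →L[ℂ] Ell2) : Prop :=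
  ∀ k l : ℕ, HasHardyInner ρ (transfer φ (hardyBasis ρ l)) (hardyBasis ρ k) (L (unit l) k)

/-- The `N × N` matrix `H_{kl} = (1/2) ∫_{-1}^1 x^k x^l dx`, `0 ≤ k, l < N`. -/
def hatH (N : ℕ) : Matrix (Fin N) (Fin N) ℂ :=
  Matrix.of fun k l =>
    (((1 / 2 : ℝ) * ∫ x in (-1 : ℝ)..1, x ^ (k : ℕ) * x ^ (l : ℕ) : ℝ) : ℂ)

/-- The `N × N` matrix `G_{kl} = (1/2) ∫_{-1}^1 T(x)^k x^l dx`, `0 ≤ k, l < N`. -/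
def hatG (T : ℝ → ℝ) (N : ℕ) : Matrix (Fin N) (Fin N) ℂ :=
  Matrix.of fun k l =>
    (((1 / 2 : ℝ) * ∫ x in (-1 : ℝ)..1, T x ^ (k : ℕ) * x ^ (l : ℕ) : ℝ) : ℂ)

/-- The operator on `ℓ²(ℕ₀)` that acts as the matrix `A` on the first `N` coordinates and
annihilates (and has range orthogonal to) all other unit vectors. -/
def lift {N : ℕ} (A : Matrix (Fin N) (Fin N) ℂ) : Ell2 →L[ℂ] Ell2 :=
  ∑ k : Fin N, ∑ l : Fin N, A k l • (innerSL ℂ (unit l)).smulRight (unit k)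

/-- `H_N^†`: the lift of the inverse matrix. -/
def opHDagger (N : ℕ) : Ell2 →L[ℂ] Ell2 := lift (hatH N)⁻¹

/-- `G_N = P_N G P_N`. -/
def opG (T : ℝ → ℝ) (N : ℕ) : Ell2 →L[ℂ] Ell2 := lift (hatG T N)

/-- `V_N = P_N V P_N`, where `V` multiplies the `n`-th coordinate by `ρ^n`. -/
def opV (ρ : ℝ) (N : ℕ) : Ell2 →L[ℂ] Ell2 :=
  lift (Matrix.diagonal fun k : Fin N => (ρ : ℂ) ^ (k : ℕ))

/-- `V_N^{-1} = P_N V^{-1} P_N`, where `V^{-1}` multiplies the `n`-th coordinate by `ρ^{-n}`. -/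
def opVInv (ρ : ℝ) (N : ℕ) : Ell2 →L[ℂ] Ell2 :=
  lift (Matrix.diagonal fun k : Fin N => ((ρ : ℂ) ^ (k : ℕ))⁻¹)

/-- The operator `V_N H_N^† G_N V_N^{-1}` on `ℓ²(ℕ₀)`. -/
def galerkin (T : ℝ → ℝ) (ρ : ℝ) (N : ℕ) : Ell2 →L[ℂ] Ell2 :=
  opV ρ N ∘L opHDagger N ∘L opG T N ∘L opVInv ρ N

/-- The constant `γ = (1 + √2)²`. -/
def gam : ℝ := (1 + Real.sqrt 2) ^ 2

/-- The choice `ρ = √(rR/γ)`. -/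
def rhoOpt (r R : ℝ) : ℝ := Real.sqrt (r * R / gam)

end EDMD

end

/-! By the change of variables `x = φ_i(y)` on each branch, `∫ T^k x^l = ∫ x^k ℒ(z^l)` over
`[-1,1]`. Hence column `l` of `H_N⁻¹ G_N` holds the coefficients of the `L²(-1,1)`-orthogonal
projection of `g = ℒ(z^l)` onto polynomials of degree less than `N`, while column `l` of `L` holds,
up to powers of `ρ`, the Taylor coefficients of `g`. The projection fixes the Taylor polynomial of
`g`, so inside the `N × N` block the error is the projection of the Taylor remainder.

Two estimates control it. First, `g` is the derivative of `∑ σ_i φ_i^(l+1)/(l+1)`, which is bounded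
by `d r^(l+1)` on `D_R`; Cauchy's estimate bounds its Taylor coefficients by a constant times `(k+1)
r^l R^(-k)`, hence the remainder on `[-1,1]` by a constant times `(N+1) r^l R^(-N)`
(`norm_taylorCoeff_transfer_pow_le`, `norm_sub_partial_sum_le`). Second, expansion in Chebyshev
polynomials of the second kind shows that passing from the `L²` norm to the coefficient norm with
weights `ρ^k` costs at most `((1+√2)ρ)^N` (`coeffNorm_le_of_degree_lt`). A second factor `(1+√2)^N`
absorbs `N+1`, which yields `γ = (1+√2)²`.

Outside the block only entries of `L` remain: rows `k ≥ N` are again covered by `(γρ/R)^N`, and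
columns `l ≥ N` contribute `(r/ρ)^N`. Operator norms are bounded by the sum of the moduli of all
entries, which is affordable because columns decay like `(r/ρ)^l`. The optimal radius comes from the
inequality of arithmetic and geometric means. -/

open Polynomial

/-! ### Polynomial coefficients against the `L²(-1,1)` norm -/

namespace EDMD

/-- A truncated weighted `ℓ¹`-norm of the coefficients of a real polynomial. -/
def coeffNorm (ρ : ℝ) (M : ℕ) (p : ℝ[X]) : ℝ := ∑ k ∈ Finset.range M, |p.coeff k| * ρ ^ k

lemma coeffNorm_add_le {ρ : ℝ} (hρ : 0 ≤ ρ) (M : ℕ) (p q : ℝ[X]) :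
    coeffNorm ρ M (p + q) ≤ coeffNorm ρ M p + coeffNorm ρ M q := by
  unfold coeffNorm
  rw [← Finset.sum_add_distrib]
  refine Finset.sum_le_sum fun k _ => ?_
  rw [coeff_add, ← add_mul]
  gcongr
  exact abs_add_le _ _

lemma coeffNorm_C_mul (ρ : ℝ) (M : ℕ) (c : ℝ) (p : ℝ[X]) :
    coeffNorm ρ M (C c * p) = |c| * coeffNorm ρ M p := by
  unfold coeffNorm
  rw [Finset.mul_sum]
  refine Finset.sum_congr rfl fun k _ => ?_
  rw [coeff_C_mul, abs_mul, mul_assoc]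

lemma coeffNorm_X_mul_le {ρ : ℝ} (hρ : 0 ≤ ρ) (M : ℕ) (p : ℝ[X]) :
    coeffNorm ρ M (X * p) ≤ ρ * coeffNorm ρ M p := by
  unfold coeffNorm
  cases M with
  | zero => simp
  | succ M =>
    rw [Finset.sum_range_succ', Finset.sum_range_succ, mul_add, Finset.mul_sum]
    simp only [coeff_X_mul, coeff_X_mul_zero, abs_zero, zero_mul, add_zero]
    have : 0 ≤ ρ * (|p.coeff M| * ρ ^ M) := by positivity
    refine le_add_of_le_of_nonneg (le_of_eq ?_) this
    exact Finset.sum_congr rfl fun k _ => by ring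

lemma coeffNorm_sum_le {ρ : ℝ} (hρ : 0 ≤ ρ) (M : ℕ) {ι : Type*} (s : Finset ι) (p : ι → ℝ[X]) :
    coeffNorm ρ M (∑ i ∈ s, p i) ≤ ∑ i ∈ s, coeffNorm ρ M (p i) := by
  classical
  induction s using Finset.induction_on with
  | empty => simp [coeffNorm]
  | insert i s hi ih =>
    rw [Finset.sum_insert hi, Finset.sum_insert hi]
    exact (coeffNorm_add_le hρ M _ _).trans (by gcongr)

lemma coeffNorm_one_le (ρ : ℝ) (M : ℕ) : coeffNorm ρ M 1 ≤ 1 := by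
  unfold coeffNorm
  cases M with
  | zero => simp
  | succ M => simp [Finset.sum_range_succ', coeff_one]

/-- The recurrence `U_(n+2) = 2X U_(n+1) - U_n` costs `2ρ` and `1`. Since `1 + √2` is the positive
root of `s² = 2s + 1` and `ρ ≥ 1`, the number `Q = (1+√2)ρ` satisfies `2ρQ + 1 ≤ Q²`. -/
lemma coeffNorm_chebyshevU_le {ρ : ℝ} (hρ : 1 ≤ ρ) (M n : ℕ) :
    coeffNorm ρ M (Chebyshev.U ℝ n) ≤ ((1 + √2) * ρ) ^ n := by
  have h0 : 0 ≤ ρ := by linarith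
  have hs : √2 ^ 2 = 2 := Real.sq_sqrt (by norm_num)
  have hs1 : 1 ≤ √2 := Real.one_le_sqrt.2 (by norm_num)
  have two_X : ∀ p : ℝ[X], coeffNorm ρ M (2 * X * p) ≤ 2 * ρ * coeffNorm ρ M p := by
    intro p
    have : 2 * X * p = C (2 : ℝ) * (X * p) := by rw [mul_assoc]; rfl
    rw [this, coeffNorm_C_mul, abs_of_pos (by norm_num), mul_assoc]
    gcongr
    exact coeffNorm_X_mul_le h0 M p
  induction n using Nat.twoStepInduction with
  | zero => simpa using coeffNorm_one_le ρ M
  | one =>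
    have h1 := two_X 1
    have h2 := coeffNorm_one_le ρ M
    simp only [Nat.cast_one, Chebyshev.U_one, pow_one, mul_one] at h1 ⊢
    nlinarith
  | more n ih1 ih2 =>
    have hU : Chebyshev.U ℝ ((n + 2 : ℕ) : ℤ)
        = 2 * X * Chebyshev.U ℝ ((n + 1 : ℕ) : ℤ) + C (-1) * Chebyshev.U ℝ (n : ℤ) := by
      push_cast
      rw [Chebyshev.U_add_two, map_neg, map_one]
      ring
    have h1 := coeffNorm_add_le h0 M (2 * X * Chebyshev.U ℝ ((n + 1 : ℕ) : ℤ))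
      (C (-1) * Chebyshev.U ℝ (n : ℤ))
    rw [coeffNorm_C_mul, abs_neg, abs_one, one_mul, ← hU] at h1
    have h2 := two_X (Chebyshev.U ℝ ((n + 1 : ℕ) : ℤ))
    have h3 : 2 * ρ * coeffNorm ρ M (Chebyshev.U ℝ ((n + 1 : ℕ) : ℤ))
        ≤ 2 * ρ * ((1 + √2) * ρ) ^ (n + 1) := by gcongr
    have h4 : (2 * ρ * ((1 + √2) * ρ) + 1) * ((1 + √2) * ρ) ^ n
        ≤ ((1 + √2) * ρ) ^ 2 * ((1 + √2) * ρ) ^ n := by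
      gcongr
      have h5 : ((1 + √2) * ρ) ^ 2 = 2 * ρ * ((1 + √2) * ρ) + ρ ^ 2 * (√2 ^ 2 - 1) := by ring
      rw [h5, hs]
      nlinarith
    calc _ ≤ 2 * ρ * ((1 + √2) * ρ) ^ (n + 1) + ((1 + √2) * ρ) ^ n := by linarith
      _ = (2 * ρ * ((1 + √2) * ρ) + 1) * ((1 + √2) * ρ) ^ n := by ring
      _ ≤ _ := h4
      _ = _ := by ring

/-- Chebyshev polynomials of the second kind span the polynomials of bounded degree. -/
lemma exists_eq_sum_chebyshevU (N : ℕ) (p : ℝ[X]) (hp : p.degree < N) :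
    ∃ c : ℕ → ℝ, p = ∑ n ∈ Finset.range N, C (c n) * Chebyshev.U ℝ (n : ℤ) := by
  induction N generalizing p with
  | zero => exact ⟨0, by simpa using hp⟩
  | succ N ih =>
    -- `2^N` is the leading coefficient of `U_N`, so subtracting `t U_N` lowers the degree.
    set t : ℝ := p.coeff N / 2 ^ N
    have hdeg : (p - C t * Chebyshev.U ℝ (N : ℤ)).degree < N := by
      rw [degree_lt_iff_coeff_zero] at hp ⊢
      intro m hm
      rcases hm.eq_or_lt with rfl | hm
      · have : (Chebyshev.U ℝ (N : ℤ)).coeff N = 2 ^ N := by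
          have := Chebyshev.leadingCoeff_U_natCast ℝ N
          rwa [leadingCoeff, Chebyshev.natDegree_U_natCast] at this
        rw [coeff_sub, coeff_C_mul, this]
        simp [t]
      · rw [coeff_sub, coeff_C_mul, hp m hm,
          coeff_eq_zero_of_natDegree_lt (by rwa [Chebyshev.natDegree_U_natCast])]
        simp
    obtain ⟨c, hc⟩ := ih _ hdeg
    refine ⟨Function.update c N t, ?_⟩
    rw [Finset.sum_range_succ, Function.update_self, ← sub_eq_iff_eq_add, hc]
    refine Finset.sum_congr rfl fun n hn => ?_
    rw [Function.update_of_ne (Finset.mem_range.1 hn).ne]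

lemma integral_sin_mul_sin (m n : ℕ) :
    ∫ θ in (0 : ℝ)..Real.pi, Real.sin ((m + 1) * θ) * Real.sin ((n + 1) * θ)
      = if m = n then Real.pi / 2 else 0 := by
  have key : ∀ k : ℤ, ∫ θ in (0 : ℝ)..Real.pi, Real.cos (k * θ)
      = if k = 0 then Real.pi else 0 := by
    intro k
    split_ifs with hk
    · simp [hk]
    · have hk' : (k : ℝ) ≠ 0 := Int.cast_ne_zero.2 hk
      rw [intervalIntegral.integral_comp_mul_left (fun x => Real.cos x) hk']
      simp [Real.sin_int_mul_pi]
  have h : ∀ θ : ℝ, Real.sin ((m + 1) * θ) * Real.sin ((n + 1) * θ)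
      = (Real.cos (((m - n : ℤ) : ℝ) * θ) - Real.cos (((m + n + 2 : ℤ) : ℝ) * θ)) / 2 := by
    intro θ
    have h1 : ((m - n : ℤ) : ℝ) * θ = (m + 1) * θ - (n + 1) * θ := by push_cast; ring
    have h2 : ((m + n + 2 : ℤ) : ℝ) * θ = (m + 1) * θ + (n + 1) * θ := by push_cast; ring
    rw [h1, h2, Real.cos_sub, Real.cos_add]
    ring
  simp_rw [h]
  rw [intervalIntegral.integral_div, intervalIntegral.integral_sub, key, key,
    if_neg (show (m + n + 2 : ℤ) ≠ 0 by omega)]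
  · by_cases hmn : m = n
    · simp [hmn]
    · rw [if_neg (by omega), if_neg hmn]; simp
  · exact Continuous.intervalIntegrable (by fun_prop) _ _
  · exact Continuous.intervalIntegrable (by fun_prop) _ _

/-- With `x = cos θ` the right side has weight `sin θ`, which dominates `sin² θ` on `[0,π]`. The
weight `sin² θ` is the one that makes the `U_n` orthogonal, because `U_n(cos θ) sin θ =
sin((n+1)θ)`. -/
lemma integral_sq_chebyshev_le (p : ℝ[X]) :
    ∫ θ in (0 : ℝ)..Real.pi, (p.eval (Real.cos θ) * Real.sin θ) ^ 2
      ≤ ∫ x in (-1 : ℝ)..1, p.eval x ^ 2 := by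
  have h := intervalIntegral.integral_comp_mul_deriv (a := 0) (b := Real.pi)
    (f := Real.cos) (f' := fun θ => -Real.sin θ) (g := fun x => p.eval x ^ 2)
    (fun x _ => Real.hasDerivAt_cos x) (by fun_prop) (by fun_prop)
  rw [Real.cos_zero, Real.cos_pi, intervalIntegral.integral_symm (-1)] at h
  simp only [Function.comp_apply, mul_neg, intervalIntegral.integral_neg, neg_inj] at h
  rw [← h]
  refine intervalIntegral.integral_mono_on Real.pi_pos.le
    (Continuous.intervalIntegrable (by fun_prop) _ _)
    (Continuous.intervalIntegrable (by fun_prop) _ _) fun θ hθ => ?_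
  rw [mul_pow]
  refine mul_le_mul_of_nonneg_left ?_ (sq_nonneg _)
  have h0 := Real.sin_nonneg_of_mem_Icc hθ
  have h1 := Real.sin_le_one θ
  nlinarith

/-- The coefficients of a polynomial in the Chebyshev basis are controlled by the
`L²(-1,1)`-norm. -/
lemma sq_chebyshev_coeff_le (N : ℕ) (c : ℕ → ℝ) {n : ℕ} (hn : n < N) :
    c n ^ 2 ≤ ∫ x in (-1 : ℝ)..1,
      (∑ n ∈ Finset.range N, C (c n) * Chebyshev.U ℝ (n : ℤ)).eval x ^ 2 := by
  set p := ∑ n ∈ Finset.range N, C (c n) * Chebyshev.U ℝ (n : ℤ) with hp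
  refine le_trans ?_ (integral_sq_chebyshev_le p)
  have hS : ∀ θ, p.eval (Real.cos θ) * Real.sin θ
      = ∑ m ∈ Finset.range N, c m * Real.sin ((m + 1) * θ) := by
    intro θ
    rw [hp, eval_finsetSum, Finset.sum_mul]
    refine Finset.sum_congr rfl fun m _ => ?_
    have := Chebyshev.U_real_cos θ (m : ℤ)
    rw [eval_mul, eval_C, mul_assoc, this]
    simp
  have hmul : ∫ θ in (0 : ℝ)..Real.pi,
      (p.eval (Real.cos θ) * Real.sin θ) * Real.sin ((n + 1) * θ) = c n * (Real.pi / 2) := by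
    simp_rw [hS, Finset.sum_mul, mul_assoc]
    rw [intervalIntegral.integral_finsetSum
      fun m _ => Continuous.intervalIntegrable (by fun_prop) _ _]
    simp_rw [intervalIntegral.integral_const_mul, integral_sin_mul_sin]
    simp [hn]
  have hsq : ∫ θ in (0 : ℝ)..Real.pi, Real.sin ((n + 1) * θ) * Real.sin ((n + 1) * θ)
      = Real.pi / 2 := by simpa using integral_sin_mul_sin n n
  -- Bessel's inequality for one coefficient: expanding this square gives `c_n² π/2` as a lower
  -- bound, and `π/2 ≥ 1`.
  have hnn : 0 ≤ ∫ θ in (0 : ℝ)..Real.pi,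
      (p.eval (Real.cos θ) * Real.sin θ - c n * Real.sin ((n + 1) * θ)) ^ 2 :=
    intervalIntegral.integral_nonneg Real.pi_pos.le fun _ _ => sq_nonneg _
  have hexp : ∀ θ, (p.eval (Real.cos θ) * Real.sin θ - c n * Real.sin ((n + 1) * θ)) ^ 2
      = (p.eval (Real.cos θ) * Real.sin θ) ^ 2
        - 2 * c n * ((p.eval (Real.cos θ) * Real.sin θ) * Real.sin ((n + 1) * θ))
        + c n ^ 2 * (Real.sin ((n + 1) * θ) * Real.sin ((n + 1) * θ)) := fun θ => by ring
  simp_rw [hexp] at hnn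
  rw [intervalIntegral.integral_add, intervalIntegral.integral_sub,
    intervalIntegral.integral_const_mul, intervalIntegral.integral_const_mul, hmul, hsq] at hnn
  · nlinarith [Real.pi_gt_three, sq_nonneg (c n)]
  all_goals exact Continuous.intervalIntegrable (by fun_prop) _ _

/-- The weighted `ℓ¹`-norm of the coefficients of a polynomial of degree less than `N` is at most
`((1 + √2) ρ)^N` times its norm in `L²(-1,1)`. -/
lemma coeffNorm_le_of_degree_lt {ρ : ℝ} (hρ : 1 ≤ ρ) (M N : ℕ) (p : ℝ[X]) (hp : p.degree < N) :
    coeffNorm ρ M p ≤ ((1 + √2) * ρ) ^ N * √(∫ x in (-1 : ℝ)..1, p.eval x ^ 2) := by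
  obtain ⟨c, hc⟩ := exists_eq_sum_chebyshevU N p hp
  set S := √(∫ x in (-1 : ℝ)..1, p.eval x ^ 2) with hS
  have hS0 : 0 ≤ S := Real.sqrt_nonneg _
  have hs1 : 1 ≤ √2 := Real.one_le_sqrt.2 (by norm_num)
  have hcn : ∀ n < N, |c n| ≤ S := fun n hn => by
    refine Real.abs_le_sqrt ?_
    rw [hc]
    exact sq_chebyshev_coeff_le N c hn
  set Q := (1 + √2) * ρ with hQ
  -- With ratio at least `2`, the geometric sum over `n < N` is at most `Q^N`, with no further
  -- constant.
  have hQ2 : 2 ≤ Q := by nlinarith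
  calc coeffNorm ρ M p
      ≤ ∑ n ∈ Finset.range N, coeffNorm ρ M (C (c n) * Chebyshev.U ℝ (n : ℤ)) := by
        conv_lhs => rw [hc]
        exact coeffNorm_sum_le (by linarith) M _ _
    _ ≤ ∑ n ∈ Finset.range N, S * Q ^ n := by
        refine Finset.sum_le_sum fun n hn => ?_
        rw [coeffNorm_C_mul]
        refine mul_le_mul (hcn n (Finset.mem_range.1 hn)) (coeffNorm_chebyshevU_le hρ M n) ?_ hS0
        exact Finset.sum_nonneg fun k _ => by positivity
    _ ≤ Q ^ N * S := by
        rw [← Finset.mul_sum, mul_comm]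
        gcongr
        have := geom_sum_mul Q N
        have h0 : 0 ≤ ∑ i ∈ Finset.range N, Q ^ i := Finset.sum_nonneg fun k _ => by positivity
        nlinarith

end EDMD

/-! ### Taylor coefficients and Hardy matrix entries of the transfer operator -/

namespace EDMD

open Metric

/-- The Taylor coefficient at `0` of index `k` of `f`. -/
noncomputable def taylorCoeff (f : ℂ → ℂ) (k : ℕ) : ℂ := (k.factorial : ℂ)⁻¹ * iteratedDeriv k f 0

lemma hasSum_taylorCoeff {f : ℂ → ℂ} {R : ℝ} (hf : DifferentiableOn ℂ f (ball 0 R)) {z : ℂ}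
    (hz : z ∈ ball (0 : ℂ) R) : HasSum (fun k => taylorCoeff f k * z ^ k) (f z) := by
  have h := Complex.hasSum_taylorSeries_on_ball hf hz
  simp only [sub_zero, smul_eq_mul] at h
  refine h.congr_fun fun k => ?_
  rw [taylorCoeff]
  ring

/-- Cauchy's estimate is applied to the primitive `F`, since `f` itself need not be bounded on the
disk; the price is the factor `k + 1`. -/
lemma norm_taylorCoeff_deriv_le {F f : ℂ → ℂ} {R M : ℝ} (hR : 0 < R)
    (hF : DifferentiableOn ℂ F (ball 0 R)) (hM : ∀ z ∈ ball (0 : ℂ) R, ‖F z‖ ≤ M)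
    (hf : ∀ z ∈ ball (0 : ℂ) R, deriv F z = f z) (k : ℕ) :
    ‖taylorCoeff f k‖ ≤ (k + 1) * M / R ^ (k + 1) := by
  have h1 : iteratedDeriv k f 0 = iteratedDeriv (k + 1) F 0 := by
    rw [iteratedDeriv_succ']
    refine Filter.EventuallyEq.iteratedDeriv_eq k ?_
    filter_upwards [isOpen_ball.mem_nhds (mem_ball_self hR)] with z hz
    exact (hf z hz).symm
  -- `F` is controlled only on the open disk, so circles of radius `s < R` are used and `s` then
  -- tends to `R`.
  have h2 : ∀ s ∈ Set.Ioo 0 R, ‖taylorCoeff f k‖ ≤ (k + 1) * M / s ^ (k + 1) := by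
    intro s hs
    have hsub : closedBall (0 : ℂ) s ⊆ ball 0 R := closedBall_subset_ball hs.2
    have h3 := Complex.norm_iteratedDeriv_le_of_forall_mem_sphere_norm_le (k + 1) hs.1
      (f := F) (c := 0) (C := M) (hF.diffContOnCl_ball hsub)
      (fun z hz => hM z (hsub (sphere_subset_closedBall hz)))
    rw [taylorCoeff, norm_mul, norm_inv, Complex.norm_natCast, h1,
      inv_mul_le_iff₀ (by positivity)]
    refine h3.trans (le_of_eq ?_)
    rw [Nat.factorial_succ]
    push_cast
    ring
  have h4 : Filter.Tendsto (fun s : ℝ => (k + 1) * M / s ^ (k + 1)) (nhdsWithin R (Set.Iio R))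
      (nhds ((k + 1) * M / R ^ (k + 1))) := by
    have : ContinuousAt (fun s : ℝ => (k + 1) * M / s ^ (k + 1)) R :=
      ContinuousAt.div (by fun_prop) (by fun_prop) (by positivity)
    exact this.mono_left nhdsWithin_le_nhds
  refine ge_of_tendsto h4 ?_
  filter_upwards [Ioo_mem_nhdsLT hR] with s hs using h2 s hs

/-- The inner products with the standard basis of the Hardy space are the scaled Taylor
coefficients. -/
lemma hasHardyInner_hardyBasis {f : ℂ → ℂ} {ρ R : ℝ} (hρ : 0 < ρ) (hρR : ρ < R)
    (hf : DifferentiableOn ℂ f (ball 0 R)) (k : ℕ) :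
    HasHardyInner ρ f (hardyBasis ρ k) ((ρ : ℂ) ^ k * taylorCoeff f k) := by
  have hlim : Filter.Tendsto (fun s : ℝ => ((s : ℂ) / ρ) ^ k * (s : ℂ) ^ k * taylorCoeff f k)
      (nhdsWithin ρ (Set.Iio ρ)) (nhds ((ρ : ℂ) ^ k * taylorCoeff f k)) := by
    have hc : Continuous (fun s : ℝ => ((s : ℂ) / ρ) ^ k * (s : ℂ) ^ k * taylorCoeff f k) := by
      fun_prop
    have := (hc.tendsto ρ).mono_left (nhdsWithin_le_nhds (s := Set.Iio ρ))
    rwa [div_self (by exact_mod_cast hρ.ne'), one_pow, one_mul] at this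
  refine hlim.congr' ?_
  filter_upwards [Ioo_mem_nhdsLT hρ] with s hs
  have hs0 : (s : ℂ) ≠ 0 := by exact_mod_cast hs.1.ne'
  have hsub : closedBall (0 : ℂ) s ⊆ ball 0 R := closedBall_subset_ball (hs.2.trans hρR)
  have h := (hf.diffContOnCl_ball hsub).circleIntegral_one_div_sub_center_pow_smul hs.1 k
  rw [circleIntegral] at h
  simp only [deriv_circleMap, sub_zero, smul_eq_mul] at h
  -- On `|z| = s` the conjugate of `e_k(z)` is `(s/ρ)^k s^k / z^k`, which turns the integrand into
  -- that of Cauchy's formula.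
  have hint : ∫ t in (0 : ℝ)..2 * Real.pi,
      f ((s : ℂ) * Complex.exp (Complex.I * t)) *
        (starRingEnd ℂ) (hardyBasis ρ k ((s : ℂ) * Complex.exp (Complex.I * t)))
      = ∫ t in (0 : ℝ)..2 * Real.pi, (((s : ℂ) / ρ) ^ k * (s : ℂ) ^ k * Complex.I⁻¹) *
        (circleMap 0 s t * Complex.I * (1 / circleMap 0 s t ^ (k + 1) * f (circleMap 0 s t))) := by
    refine intervalIntegral.integral_congr fun t _ => ?_
    simp only [circleMap_zero, mul_comm Complex.I (t : ℂ)]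
    have hE := Complex.exp_ne_zero (t * Complex.I)
    have hconj : (starRingEnd ℂ) (Complex.exp (t * Complex.I))
        = (Complex.exp (t * Complex.I))⁻¹ := by
      rw [← Complex.exp_conj, ← Complex.exp_neg]
      simp
    set E := Complex.exp (t * Complex.I)
    have hρ0 : (ρ : ℂ) ≠ 0 := by exact_mod_cast hρ.ne'
    simp only [hardyBasis, map_pow, map_div₀, map_mul, hconj, Complex.conj_ofReal]
    simp only [div_pow, mul_pow, inv_pow]
    field_simp
    ring
  rw [hint, intervalIntegral.integral_const_mul, h, taylorCoeff]
  have hπ : (Real.pi : ℂ) ≠ 0 := by exact_mod_cast Real.pi_ne_zero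
  field_simp

variable {d : ℕ} {φ : Fin d → ℂ → ℂ} {T : ℝ → ℝ} {a b : Fin d → ℝ} {r R : ℝ}

lemma differentiableOn_transfer (hφ : HasHolomorphicInverseBranches T a b φ r R) {f : ℂ → ℂ}
    (hf : Differentiable ℂ f) : DifferentiableOn ℂ (transfer φ f) (ball 0 R) := by
  unfold transfer
  refine DifferentiableOn.fun_sum fun i _ => DifferentiableOn.mul (DifferentiableOn.const_mul
    ((hφ.differentiableOn i).deriv isOpen_ball) _) ?_
  exact hf.comp_differentiableOn (hφ.differentiableOn i)

lemma norm_taylorCoeff_transfer_pow_le (hφ : HasHolomorphicInverseBranches T a b φ r R)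
    (hR : 0 < R) (l k : ℕ) :
    ‖taylorCoeff (transfer φ fun z => z ^ l) k‖ ≤ d * r / R * r ^ l * ((k + 1) * (R ^ k)⁻¹) := by
  have hF : DifferentiableOn ℂ
      (fun z => ∑ i, (Real.sign (deriv (φ i) 0).re : ℂ) * (φ i z ^ (l + 1) / (l + 1)))
      (ball 0 R) :=
    DifferentiableOn.fun_sum fun i _ =>
      (((hφ.differentiableOn i).pow _).div_const _).const_mul _
  have h := norm_taylorCoeff_deriv_le (M := d * r ^ (l + 1)) hR hF
    (f := transfer φ fun z => z ^ l) ?_ ?_ k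
  · refine h.trans (le_of_eq ?_)
    field_simp
    ring
  · intro z hz
    refine (norm_sum_le _ _).trans ?_
    have : ∀ i ∈ (Finset.univ : Finset (Fin d)),
        ‖(Real.sign (deriv (φ i) 0).re : ℂ) * (φ i z ^ (l + 1) / (l + 1))‖ ≤ r ^ (l + 1) := by
      intro i _
      have h1 : ‖(Real.sign (deriv (φ i) 0).re : ℂ)‖ ≤ 1 := by
        rw [Complex.norm_real]
        rcases Real.sign_apply_eq (deriv (φ i) 0).re with h | h | h <;> simp [h]
      have h2 : ‖φ i z‖ ≤ r := by
        have := hφ.mapsTo i hz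
        rw [mem_ball_zero_iff] at this
        exact this.le
      have h3 : 1 ≤ ‖(l + 1 : ℂ)‖ := by
        have : ‖(l + 1 : ℂ)‖ = l + 1 := by exact_mod_cast Complex.norm_natCast (l + 1)
        rw [this]
        simp
      rw [norm_mul, norm_div, norm_pow]
      calc _ ≤ 1 * (‖φ i z‖ ^ (l + 1) / 1) := by gcongr
        _ ≤ r ^ (l + 1) := by rw [one_mul, div_one]; gcongr
    simpa using Finset.sum_le_card_nsmul _ _ _ this
  · intro z hz
    have hd : ∀ i, HasDerivAt (φ i) (deriv (φ i) z) z := fun i =>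
      ((hφ.differentiableOn i).differentiableAt (isOpen_ball.mem_nhds hz)).hasDerivAt
    refine (HasDerivAt.fun_sum fun i _ =>
      (((hd i).pow (l + 1)).div_const ((l : ℂ) + 1)).const_mul _).deriv.trans ?_
    refine Finset.sum_congr rfl fun i _ => ?_
    have : (l : ℂ) + 1 ≠ 0 := by exact_mod_cast l.succ_ne_zero
    push_cast
    field_simp

lemma isTransferMatrix_entry (hφ : HasHolomorphicInverseBranches T a b φ r R) {ρ : ℝ}
    (hρ : 0 < ρ) (hρR : ρ < R) (k l : ℕ) :
    HasHardyInner ρ (transfer φ (hardyBasis ρ l)) (hardyBasis ρ k)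
      (((ρ : ℂ) ^ l)⁻¹ * ((ρ : ℂ) ^ k * taylorCoeff (transfer φ fun z => z ^ l) k)) := by
  have h := (hasHardyInner_hardyBasis hρ hρR
    (differentiableOn_transfer hφ (f := fun z => z ^ l) (by fun_prop)) k).const_mul
    (((ρ : ℂ) ^ l)⁻¹)
  refine h.congr fun s => ?_
  rw [mul_left_comm, ← intervalIntegral.integral_const_mul]
  congr 2
  funext t
  simp only [transfer, hardyBasis, div_pow, Finset.sum_mul, Finset.mul_sum]
  refine Finset.sum_congr rfl fun i _ => ?_
  ring

end EDMD
-- Duality between composition with `T` and the transfer operator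
open MeasureTheory

namespace EDMD

open Metric

variable {d : ℕ} {φ : Fin d → ℂ → ℂ} {T : ℝ → ℝ} {a b : Fin d → ℝ} {r R : ℝ}

lemma IsAnalyticFullBranchMap.Icc_subset (hT : IsAnalyticFullBranchMap T a b) (i : Fin d) :
    Set.Icc (a i) (b i) ⊆ Set.Icc (-1) 1 := by
  rw [← hT.iUnion_eq]
  exact Set.subset_iUnion (fun i => Set.Icc (a i) (b i)) i

lemma IsAnalyticFullBranchMap.image_Ioo_subset (hT : IsAnalyticFullBranchMap T a b) (i : Fin d) :
    T '' Set.Ioo (a i) (b i) ⊆ Set.Icc (-1) 1 := by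
  rintro _ ⟨x, hx, rfl⟩
  exact hT.mapsTo (hT.Icc_subset i (Set.Ioo_subset_Icc_self hx))

/-- Density of `T(I_i)` is assumed with arbitrary endpoint values. Removing `T (a i)` and `T (b i)`
from the target interval leaves a nonempty open set, which forces the point found to come from the
interior of the branch. -/
lemma IsAnalyticFullBranchMap.Ioo_inter_image (hT : IsAnalyticFullBranchMap T a b) (i : Fin d)
    {u v : ℝ} (hu : -1 ≤ u) (huv : u < v) (hv : v ≤ 1) :
    (Set.Ioo u v ∩ T '' Set.Ioo (a i) (b i)).Nonempty := by
  have hopen : IsOpen (Set.Ioo u v \ {T (a i), T (b i)}) :=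
    isOpen_Ioo.sdiff (Set.toFinite _).isClosed
  obtain ⟨y, hy⟩ : (Set.Ioo u v \ {T (a i), T (b i)}).Nonempty :=
    ((Set.Ioo_infinite huv).sdiff (Set.toFinite _)).nonempty
  have hyc : y ∈ closure (T '' Set.Icc (a i) (b i)) := by
    rw [hT.full i]
    exact ⟨hu.trans hy.1.1.le, hy.1.2.le.trans hv⟩
  obtain ⟨_, hz, x, hx, rfl⟩ := mem_closure_iff.1 hyc _ hopen hy
  have hz2 := hz.2
  simp only [Set.mem_insert_iff, Set.mem_singleton_iff, not_or] at hz2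
  refine ⟨T x, hz.1, x, ⟨lt_of_le_of_ne hx.1 ?_, lt_of_le_of_ne hx.2 ?_⟩, rfl⟩
  · rintro rfl; exact hz2.1 rfl
  · rintro rfl; exact hz2.2 rfl

/-- Each branch covers the whole open interval. -/
lemma IsAnalyticFullBranchMap.Ioo_subset_image (hT : IsAnalyticFullBranchMap T a b) (i : Fin d) :
    Set.Ioo (-1) 1 ⊆ T '' Set.Ioo (a i) (b i) := by
  intro y hy
  obtain ⟨u, hu, hu'⟩ := hT.Ioo_inter_image i le_rfl hy.1 hy.2.le
  obtain ⟨v, hv, hv'⟩ := hT.Ioo_inter_image i hy.1.le hy.2 le_rfl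
  have hJ : (T '' Set.Ioo (a i) (b i)).OrdConnected :=
    (isPreconnected_Ioo.image T (hT.analytic i).continuousOn).ordConnected
  exact hJ.out hu' hv' ⟨hu.2.le, hv.1.le⟩

lemma ofReal_mem_ball (hR : 1 < R) {y : ℝ} (hy : y ∈ Set.Icc (-1 : ℝ) 1) :
    (y : ℂ) ∈ ball (0 : ℂ) R := by
  rw [mem_ball_zero_iff, Complex.norm_real]
  exact (abs_le.2 hy).trans_lt hR

/-- On the open interval the holomorphic inverse branches are real-valued inverses of `T`. -/
lemma exists_eq_ofReal (hT : IsAnalyticFullBranchMap T a b)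
    (hφ : HasHolomorphicInverseBranches T a b φ r R) (i : Fin d) {y : ℝ}
    (hy : y ∈ Set.Ioo (-1 : ℝ) 1) :
    ∃ x ∈ Set.Ioo (a i) (b i), T x = y ∧ φ i y = x := by
  obtain ⟨x, hx, rfl⟩ := hT.Ioo_subset_image i hy
  exact ⟨x, hx, rfl, hφ.left_inv i x hx⟩

lemma hasDerivAt_re_branch (hR : 1 < R)
    (hφ : HasHolomorphicInverseBranches T a b φ r R) (i : Fin d) {y : ℝ}
    (hy : y ∈ Set.Icc (-1 : ℝ) 1) :
    HasDerivAt (fun t : ℝ => (φ i t).re) (deriv (φ i) y).re y :=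
  ((hφ.differentiableOn i).differentiableAt
    (isOpen_ball.mem_nhds (ofReal_mem_ball hR hy))).hasDerivAt.real_of_complex

lemma deriv_branch_eq_re (hR : 1 < R) (hT : IsAnalyticFullBranchMap T a b)
    (hφ : HasHolomorphicInverseBranches T a b φ r R) (i : Fin d) {y : ℝ}
    (hy : y ∈ Set.Ioo (-1 : ℝ) 1) :
    deriv (φ i) y = ((deriv (φ i) y).re : ℂ) := by
  have hy' := Set.Ioo_subset_Icc_self hy
  have h1 : HasDerivAt (fun t : ℝ => φ i t) (deriv (φ i) y) y :=
    ((hφ.differentiableOn i).differentiableAt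
      (isOpen_ball.mem_nhds (ofReal_mem_ball hR hy'))).hasDerivAt.comp_ofReal
  have h2 := (hasDerivAt_re_branch hR hφ i hy').ofReal_comp
  refine h1.unique (h2.congr_of_eventuallyEq ?_)
  filter_upwards [isOpen_Ioo.mem_nhds hy] with t ht
  obtain ⟨x, -, -, hx⟩ := exists_eq_ofReal hT hφ i ht
  rw [hx, Complex.ofReal_re]

/-- Near `y` the composition of `T` with the branch is the identity, so by the chain rule the
derivative of the branch is a factor of `1`. -/
lemma re_deriv_branch_ne_zero (hR : 1 < R) (hT : IsAnalyticFullBranchMap T a b)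
    (hφ : HasHolomorphicInverseBranches T a b φ r R) (i : Fin d) {y : ℝ}
    (hy : y ∈ Set.Ioo (-1 : ℝ) 1) : (deriv (φ i) y).re ≠ 0 := by
  obtain ⟨x, hx, hxy, hφx⟩ := exists_eq_ofReal hT hφ i hy
  have h1 := hasDerivAt_re_branch hR hφ i (Set.Ioo_subset_Icc_self hy)
  have hre : (φ i y).re = x := by rw [hφx, Complex.ofReal_re]
  have h2 : HasDerivAt T (deriv T x) ((φ i y).re) := by
    rw [hre]
    exact (hT.analytic i x hx).differentiableAt.hasDerivAt
  have h3 := h2.comp y h1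
  have h4 : HasDerivAt (T ∘ fun t : ℝ => (φ i t).re) 1 y := by
    refine (hasDerivAt_id y).congr_of_eventuallyEq ?_
    filter_upwards [isOpen_Ioo.mem_nhds hy] with t ht
    obtain ⟨u, -, hut, hφu⟩ := exists_eq_ofReal hT hφ i ht
    simp [hφu, hut]
  intro h0
  have := h3.unique h4
  rw [h0, mul_zero] at this
  exact zero_ne_one this

/-- The derivative of an inverse branch keeps its sign on the interval. -/
lemma abs_re_deriv_branch (hR : 1 < R) (hT : IsAnalyticFullBranchMap T a b)
    (hφ : HasHolomorphicInverseBranches T a b φ r R) (i : Fin d) {y : ℝ}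
    (hy : y ∈ Set.Ioo (-1 : ℝ) 1) :
    |(deriv (φ i) y).re| = Real.sign (deriv (φ i) 0).re * (deriv (φ i) y).re := by
  have hcont : ContinuousOn (fun t : ℝ => (deriv (φ i) t).re) (Set.Ioo (-1) 1) := by
    refine Complex.continuous_re.comp_continuousOn ?_
    refine ((hφ.differentiableOn i).deriv isOpen_ball).continuousOn.comp
      Complex.continuous_ofReal.continuousOn fun t ht => ?_
    exact ofReal_mem_ball hR (Set.Ioo_subset_Icc_self ht)
  have hne : ∀ t ∈ Set.Ioo (-1 : ℝ) 1, (deriv (φ i) t).re ≠ 0 := fun t ht =>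
    re_deriv_branch_ne_zero hR hT hφ i ht
  have hJ := (isPreconnected_Ioo.image _ hcont).ordConnected
  have h0m : (0 : ℝ) ∈ Set.Ioo (-1 : ℝ) 1 := by norm_num
  have hnot : ∀ s ∈ Set.Ioo (-1 : ℝ) 1, ∀ t ∈ Set.Ioo (-1 : ℝ) 1,
      ¬ ((deriv (φ i) s).re < 0 ∧ 0 < (deriv (φ i) t).re) := by
    rintro s hs t ht ⟨h1, h2⟩
    obtain ⟨u, hu, hu0⟩ := hJ.out ⟨s, hs, rfl⟩ ⟨t, ht, rfl⟩ ⟨h1.le, h2.le⟩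
    exact hne u hu hu0
  have h00 := hne 0 h0m
  have hyy := hne y hy
  have hn1 := hnot 0 h0m y hy
  have hn2 := hnot y hy 0 h0m
  rw [Complex.ofReal_zero] at h00 hn1 hn2
  rcases h00.lt_or_gt with h | h
  · have : (deriv (φ i) y).re < 0 := by
      by_contra! hc
      exact hn1 ⟨h, lt_of_le_of_ne hc hyy.symm⟩
    rw [Real.sign_of_neg h, abs_of_neg this]; ring
  · have : 0 < (deriv (φ i) y).re := by
      by_contra! hc
      exact hn2 ⟨lt_of_le_of_ne hc hyy, h⟩
    rw [Real.sign_of_pos h, abs_of_pos this]; ring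

/-- Substitution by the inverse branch on the image `J` of the open branch interval. `J` lies
between the open and the closed interval, hence equals `(-1,1)` up to a null set; the constant sign
of the derivative replaces its modulus by `σ_i φ_i'`. -/
lemma setIntegral_branch (hR : 1 < R) (hT : IsAnalyticFullBranchMap T a b)
    (hφ : HasHolomorphicInverseBranches T a b φ r R) (i : Fin d) (k l : ℕ) :
    ∫ x in Set.Ioo (a i) (b i), ((T x ^ k * x ^ l : ℝ) : ℂ)
      = ∫ y in Set.Ioo (-1 : ℝ) 1, (y : ℂ) ^ k *
        ((Real.sign (deriv (φ i) 0).re : ℂ) * deriv (φ i) y * φ i y ^ l) := by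
  set J := T '' Set.Ioo (a i) (b i) with hJdef
  have hJ : J.OrdConnected :=
    (isPreconnected_Ioo.image T (hT.analytic i).continuousOn).ordConnected
  have hJIcc : J ⊆ Set.Icc (-1) 1 := hT.image_Ioo_subset i
  have hinv : ∀ x ∈ Set.Ioo (a i) (b i), (φ i (T x)).re = x := fun x hx => by
    rw [hφ.left_inv i x hx, Complex.ofReal_re]
  have himage : (fun t : ℝ => (φ i t).re) '' J = Set.Ioo (a i) (b i) := by
    rw [hJdef, Set.image_image]
    exact (Set.image_congr hinv).trans (Set.image_id' _)
  have hinj : Set.InjOn (fun t : ℝ => (φ i t).re) J := by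
    rintro _ ⟨x, hx, rfl⟩ _ ⟨x', hx', rfl⟩ h
    simp only [hinv x hx, hinv x' hx'] at h
    rw [h]
  have hcv := integral_image_eq_integral_abs_deriv_smul hJ.measurableSet
    (fun y hy => (hasDerivAt_re_branch hR hφ i (hJIcc hy)).hasDerivWithinAt) hinj
    (fun x => ((T x ^ k * x ^ l : ℝ) : ℂ))
  rw [himage] at hcv
  rw [hcv]
  have hae : J =ᵐ[volume] Set.Ioo (-1 : ℝ) 1 :=
    Filter.EventuallyLE.antisymm
      ((LE.le.eventuallyLE hJIcc).trans Ioo_ae_eq_Icc.symm.le)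
      (LE.le.eventuallyLE (hT.Ioo_subset_image i))
  rw [setIntegral_congr_set hae]
  refine setIntegral_congr_fun measurableSet_Ioo fun y hy => ?_
  obtain ⟨x, hx, hxy, hφx⟩ := exists_eq_ofReal hT hφ i hy
  rw [abs_re_deriv_branch hR hT hφ i hy, deriv_branch_eq_re hR hT hφ i hy, hφx]
  simp only [Complex.ofReal_re]
  rw [hxy, Complex.real_smul]
  push_cast
  ring

lemma integrableOn_branch (hT : IsAnalyticFullBranchMap T a b) (i : Fin d) (k l : ℕ) :
    IntegrableOn (fun x => ((T x ^ k * x ^ l : ℝ) : ℂ)) (Set.Ioo (a i) (b i)) := by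
  have hc : ContinuousOn (fun x => ((T x ^ k * x ^ l : ℝ) : ℂ)) (Set.Ioo (a i) (b i)) := by
    refine Complex.continuous_ofReal.comp_continuousOn ?_
    exact ((hT.analytic i).continuousOn.pow k).mul (continuous_pow l).continuousOn
  refine Integrable.of_bound (hc.aestronglyMeasurable measurableSet_Ioo) 1 ?_
  refine (ae_restrict_iff' measurableSet_Ioo).2 (Filter.Eventually.of_forall fun x hx => ?_)
  have hx' := hT.Icc_subset i (Set.Ioo_subset_Icc_self hx)
  have h1 : |T x| ≤ 1 := abs_le.2 (hT.mapsTo hx')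
  have h2 : |x| ≤ 1 := abs_le.2 hx'
  rw [Complex.norm_real, Real.norm_eq_abs, abs_mul, abs_pow, abs_pow]
  exact mul_le_one₀ (pow_le_one₀ (abs_nonneg _) h1) (by positivity)
    (pow_le_one₀ (abs_nonneg _) h2)

/-- The duality between composition with `T` and the transfer operator, on monomials. -/
lemma integral_pow_mul_pow_eq (hR : 1 < R) (hT : IsAnalyticFullBranchMap T a b)
    (hφ : HasHolomorphicInverseBranches T a b φ r R) (k l : ℕ) :
    ((∫ x in (-1 : ℝ)..1, T x ^ k * x ^ l : ℝ) : ℂ)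
      = ∫ x in (-1 : ℝ)..1, (x : ℂ) ^ k * transfer φ (fun z => z ^ l) x := by
  rw [← intervalIntegral.integral_ofReal, intervalIntegral.integral_of_le (by norm_num),
    intervalIntegral.integral_of_le (by norm_num), ← integral_Icc_eq_integral_Ioc,
    integral_Ioc_eq_integral_Ioo, ← hT.iUnion_eq]
  have hae : (⋃ i, Set.Icc (a i) (b i)) =ᵐ[volume] ⋃ i, Set.Ioo (a i) (b i) :=
    Filter.EventuallyEq.countable_iUnion fun i => Ioo_ae_eq_Icc.symm
  rw [setIntegral_congr_set hae, integral_iUnion_fintype (fun i => measurableSet_Ioo) hT.disjoint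
    (fun i => integrableOn_branch hT i k l)]
  simp_rw [setIntegral_branch hR hT hφ, transfer, Finset.mul_sum]
  rw [integral_finsetSum]
  intro i _
  have hc : ContinuousOn (fun y : ℝ => (y : ℂ) ^ k *
      ((Real.sign (deriv (φ i) 0).re : ℂ) * deriv (φ i) y * φ i y ^ l)) (Set.Icc (-1) 1) := by
    have hmaps : Set.MapsTo (fun t : ℝ => (t : ℂ)) (Set.Icc (-1) 1) (ball (0 : ℂ) R) :=
      fun t ht => ofReal_mem_ball hR ht
    have h1 : ContinuousOn (fun y : ℝ => deriv (φ i) y) (Set.Icc (-1) 1) :=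
      ((hφ.differentiableOn i).deriv isOpen_ball).continuousOn.comp
        Complex.continuous_ofReal.continuousOn hmaps
    have h2 : ContinuousOn (fun y : ℝ => φ i y) (Set.Icc (-1) 1) :=
      (hφ.differentiableOn i).continuousOn.comp Complex.continuous_ofReal.continuousOn hmaps
    exact (Complex.continuous_ofReal.continuousOn.pow k).mul
      ((continuousOn_const.mul h1).mul (h2.pow l))
  exact (hc.integrableOn_compact isCompact_Icc).mono_set Set.Ioo_subset_Icc_self

end EDMD
-- Stability of the moment system and the error in the `N × N` block
open MeasureTheory Polynomial

namespace EDMD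

/-- If the moments of a polynomial of degree less than `N` up to order `N` are those of a function
bounded by `η` on `[-1,1]`, then its coefficients are controlled by `η`. -/
lemma sum_abs_coeff_le_of_moments {ρ : ℝ} (hρ : 1 ≤ ρ) {N : ℕ} (v : Fin N → ℝ) {h : ℝ → ℝ} {η : ℝ}
    (hc : ContinuousOn h (Set.Icc (-1) 1)) (hη : ∀ x ∈ Set.Icc (-1 : ℝ) 1, |h x| ≤ η)
    (hv : ∀ k : Fin N, ∑ j : Fin N, (∫ x in (-1 : ℝ)..1, x ^ (k : ℕ) * x ^ (j : ℕ)) * v j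
      = ∫ x in (-1 : ℝ)..1, x ^ (k : ℕ) * h x) :
    ∑ k : Fin N, |v k| * ρ ^ (k : ℕ) ≤ 2 * η * ((1 + √2) * ρ) ^ N := by
  set p : ℝ[X] := ∑ j : Fin N, C (v j) * X ^ (j : ℕ) with hp
  have hdeg : p.degree < N := degree_sum_fin_lt v
  have hcoeff : ∀ k : Fin N, p.coeff k = v k := by
    intro k
    simp [hp, finsetSum_coeff, coeff_X_pow, Fin.val_inj]
  have heval : ∀ x, p.eval x = ∑ j : Fin N, v j * x ^ (j : ℕ) := by
    intro x
    simp [hp, eval_finsetSum]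
  have hη0 : 0 ≤ η := (abs_nonneg _).trans (hη 0 (by norm_num))
  have hh : ContinuousOn h (Set.uIcc (-1) 1) := by rwa [Set.uIcc_of_le (by norm_num)]
  have hpc : ContinuousOn (fun x => p.eval x) (Set.uIcc (-1) 1) := by fun_prop
  have hmom : ∀ k : Fin N, ∫ x in (-1 : ℝ)..1, x ^ (k : ℕ) * p.eval x
      = ∫ x in (-1 : ℝ)..1, x ^ (k : ℕ) * h x := by
    intro k
    rw [← hv k]
    simp_rw [heval, Finset.mul_sum]
    rw [intervalIntegral.integral_finsetSum
      fun m _ => Continuous.intervalIntegrable (by fun_prop) _ _]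
    refine Finset.sum_congr rfl fun j _ => ?_
    rw [← intervalIntegral.integral_mul_const]
    congr 1
    funext x
    ring
  have hpair : ∀ f : ℝ → ℝ, ContinuousOn f (Set.uIcc (-1) 1) →
      ∫ x in (-1 : ℝ)..1, p.eval x * f x
        = ∑ k : Fin N, v k * ∫ x in (-1 : ℝ)..1, x ^ (k : ℕ) * f x := by
    intro f hf
    simp_rw [heval, Finset.sum_mul, mul_assoc]
    rw [intervalIntegral.integral_finsetSum]
    · simp_rw [intervalIntegral.integral_const_mul]
    · intro m _
      refine ContinuousOn.intervalIntegrable ?_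
      exact continuousOn_const.mul ((continuous_pow _).continuousOn.mul hf)
  -- By linearity in the first factor, `p - h` is orthogonal to `p`: thus `p` is the projection of
  -- `h`, and `∫ p² ≤ ∫ h²` follows from `0 ≤ ∫ (p - h)²`.
  have hpp : ∫ x in (-1 : ℝ)..1, p.eval x * p.eval x = ∫ x in (-1 : ℝ)..1, p.eval x * h x := by
    rw [hpair _ hpc, hpair _ hh]
    simp_rw [hmom]
  have hnn : 0 ≤ ∫ x in (-1 : ℝ)..1, (p.eval x - h x) ^ 2 :=
    intervalIntegral.integral_nonneg (by norm_num) fun _ _ => sq_nonneg _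
  have hexp : ∀ x, (p.eval x - h x) ^ 2
      = p.eval x * p.eval x - 2 * (p.eval x * h x) + h x ^ 2 := fun x => by ring
  simp_rw [hexp] at hnn
  rw [intervalIntegral.integral_add, intervalIntegral.integral_sub,
    intervalIntegral.integral_const_mul, hpp] at hnn
  rotate_left
  · exact (hpc.mul hpc).intervalIntegrable
  · exact (continuousOn_const.mul (hpc.mul hh)).intervalIntegrable
  · exact ((hpc.mul hpc).sub (continuousOn_const.mul (hpc.mul hh))).intervalIntegrable
  · exact (hh.pow 2).intervalIntegrable
  have hhsq : ∫ x in (-1 : ℝ)..1, h x ^ 2 ≤ ∫ x in (-1 : ℝ)..1, η ^ 2 := by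
    refine intervalIntegral.integral_mono_on (by norm_num) (hh.pow 2).intervalIntegrable
      intervalIntegrable_const fun x hx => ?_
    exact sq_le_sq.2 ((hη x hx).trans (le_abs_self η))
  rw [intervalIntegral.integral_const, smul_eq_mul] at hhsq
  -- The interval has length `2`, so `∫ p² ≤ 2η² ≤ (2η)²`.
  have hL2 : √(∫ x in (-1 : ℝ)..1, p.eval x ^ 2) ≤ 2 * η := by
    refine Real.sqrt_le_iff.2 ⟨by positivity, ?_⟩
    simp_rw [sq (eval _ p), hpp]
    nlinarith
  have hQ : 0 ≤ ((1 + √2) * ρ) ^ N := by positivity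
  calc ∑ k : Fin N, |v k| * ρ ^ (k : ℕ) = coeffNorm ρ N p := by
        rw [coeffNorm, ← Fin.sum_univ_eq_sum_range (fun k => |p.coeff k| * ρ ^ k)]
        simp_rw [hcoeff]
    _ ≤ ((1 + √2) * ρ) ^ N * √(∫ x in (-1 : ℝ)..1, p.eval x ^ 2) :=
        coeffNorm_le_of_degree_lt hρ N N p hdeg
    _ ≤ ((1 + √2) * ρ) ^ N * (2 * η) := by gcongr
    _ = _ := by ring

lemma re_intervalIntegral {f : ℝ → ℂ} {u v : ℝ} (hf : IntervalIntegrable f volume u v) :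
    (∫ x in u..v, f x).re = ∫ x in u..v, (f x).re :=
  (Complex.reCLM.intervalIntegral_comp_comm hf).symm

lemma im_intervalIntegral {f : ℝ → ℂ} {u v : ℝ} (hf : IntervalIntegrable f volume u v) :
    (∫ x in u..v, f x).im = ∫ x in u..v, (f x).im :=
  (Complex.imCLM.intervalIntegral_comp_comm hf).symm

/-- Stability of the solution of a linear system with the matrix `hatH N`. -/
lemma sum_norm_le_of_hatH_mulVec {ρ : ℝ} (hρ : 1 ≤ ρ) {N : ℕ} (w : Fin N → ℂ) {h : ℝ → ℂ} {η : ℝ}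
    (hc : ContinuousOn h (Set.Icc (-1) 1)) (hη : ∀ x ∈ Set.Icc (-1 : ℝ) 1, ‖h x‖ ≤ η)
    (hw : ∀ k : Fin N, (hatH N).mulVec w k
      = (1 / 2 : ℝ) * ∫ x in (-1 : ℝ)..1, (x : ℂ) ^ (k : ℕ) * h x) :
    ∑ k : Fin N, ‖w k‖ * ρ ^ (k : ℕ) ≤ 4 * η * ((1 + √2) * ρ) ^ N := by
  have hint : ∀ k : ℕ, IntervalIntegrable (fun x : ℝ => (x : ℂ) ^ k * h x) volume (-1) 1 := by
    intro k
    refine ContinuousOn.intervalIntegrable ?_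
    rw [Set.uIcc_of_le (by norm_num)]
    exact (Complex.continuous_ofReal.continuousOn.pow k).mul hc
  -- The matrix is real, so real and imaginary parts decouple; each contributes `2η`, which gives
  -- the constant `4`.
  have hre := sum_abs_coeff_le_of_moments hρ (fun k => (w k).re) (h := fun x => (h x).re)
    (Complex.continuous_re.comp_continuousOn hc)
    (fun x hx => (Complex.abs_re_le_norm _).trans (hη x hx)) (fun k => by
      have := congrArg Complex.re (hw k)
      rw [Complex.re_ofReal_mul, re_intervalIntegral (hint k)] at this
      simp only [Matrix.mulVec, dotProduct, hatH, Matrix.of_apply, Complex.re_sum,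
        Complex.re_ofReal_mul, ← Complex.ofReal_pow, mul_assoc, ← Finset.mul_sum] at this
      linarith)
  have him := sum_abs_coeff_le_of_moments hρ (fun k => (w k).im) (h := fun x => (h x).im)
    (Complex.continuous_im.comp_continuousOn hc)
    (fun x hx => (Complex.abs_im_le_norm _).trans (hη x hx)) (fun k => by
      have := congrArg Complex.im (hw k)
      rw [Complex.im_ofReal_mul, im_intervalIntegral (hint k)] at this
      simp only [Matrix.mulVec, dotProduct, hatH, Matrix.of_apply, Complex.im_sum,
        Complex.im_ofReal_mul, ← Complex.ofReal_pow, mul_assoc, ← Finset.mul_sum] at this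
      linarith)
  calc ∑ k : Fin N, ‖w k‖ * ρ ^ (k : ℕ)
      ≤ ∑ k : Fin N, (|(w k).re| * ρ ^ (k : ℕ) + |(w k).im| * ρ ^ (k : ℕ)) := by
        refine Finset.sum_le_sum fun k _ => ?_
        rw [← add_mul]
        gcongr
        exact Complex.norm_le_abs_re_add_abs_im _
    _ ≤ _ := by
        rw [Finset.sum_add_distrib]
        linarith

/-- The stability estimate with zero right-hand side forces the kernel to be trivial. -/
lemma isUnit_hatH (N : ℕ) : IsUnit (hatH N) := by
  rw [← Matrix.mulVec_injective_iff_isUnit]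
  refine (injective_iff_map_eq_zero (hatH N).mulVecLin).2 fun w hw => ?_
  have h := sum_norm_le_of_hatH_mulVec (ρ := 1) le_rfl w (h := fun _ => 0) (η := 0)
    continuousOn_const (by simp) (fun k => by
      have := congrFun hw k
      simpa using this)
  simp only [one_pow, mul_one, mul_zero, zero_mul] at h
  have h0 := (Finset.sum_eq_zero_iff_of_nonneg fun k _ => norm_nonneg (w k)).1
    (le_antisymm h (Finset.sum_nonneg fun k _ => norm_nonneg (w k)))
  funext k
  exact norm_eq_zero.1 (h0 k (Finset.mem_univ k))

/-- The sum of the series `∑ (k+1) x^k`. -/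
noncomputable def geomDerivSum (x : ℝ) : ℝ := ∑' k : ℕ, (k + 1) * x ^ k

lemma summable_succ_mul_pow {x : ℝ} (h0 : 0 ≤ x) (h1 : x < 1) :
    Summable fun k : ℕ => ((k : ℝ) + 1) * x ^ k := by
  have h := summable_pow_mul_geometric_of_norm_lt_one 1
    (show ‖x‖ < 1 by rwa [Real.norm_of_nonneg h0])
  have h' := summable_geometric_of_lt_one h0 h1
  refine (h.add h').congr fun k => ?_
  ring

lemma geomDerivSum_nonneg {x : ℝ} (h0 : 0 ≤ x) : 0 ≤ geomDerivSum x :=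
  tsum_nonneg fun k => by positivity

lemma tsum_tail_succ_mul_pow_le {x : ℝ} (h0 : 0 ≤ x) (h1 : x < 1) (N : ℕ) :
    ∑' k : ℕ, (((k + N : ℕ) : ℝ) + 1) * x ^ (k + N) ≤ (N + 1) * x ^ N * geomDerivSum x := by
  rw [geomDerivSum, ← tsum_mul_left]
  refine Summable.tsum_le_tsum (fun k => ?_)
    ((summable_nat_add_iff N).2 (summable_succ_mul_pow h0 h1))
    ((summable_succ_mul_pow h0 h1).mul_left _)
  have h2 : (((k + N : ℕ) : ℝ) + 1) ≤ (N + 1) * (k + 1) := by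
    push_cast
    nlinarith [(Nat.cast_nonneg k : (0 : ℝ) ≤ k), (Nat.cast_nonneg N : (0 : ℝ) ≤ N),
      mul_nonneg (Nat.cast_nonneg k : (0 : ℝ) ≤ k) (Nat.cast_nonneg N : (0 : ℝ) ≤ N)]
  calc _ ≤ ((N + 1) * (k + 1)) * x ^ (k + N) := by gcongr
    _ = _ := by rw [pow_add]; ring

lemma norm_sub_partial_sum_le {c : ℕ → ℂ} {g z : ℂ} {A R : ℝ} (hR : 1 < R) (hz : ‖z‖ ≤ 1)
    (hA : ∀ k, ‖c k‖ ≤ A * ((k + 1) * (R ^ k)⁻¹)) (hg : HasSum (fun k => c k * z ^ k) g) (N : ℕ) :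
    ‖g - ∑ k ∈ Finset.range N, c k * z ^ k‖ ≤ A * ((N + 1) * R⁻¹ ^ N * geomDerivSum R⁻¹) := by
  have hR0 : 0 ≤ R⁻¹ := by positivity
  have hR1 : R⁻¹ < 1 := inv_lt_one_of_one_lt₀ hR
  have hA0 : 0 ≤ A := by simpa using (norm_nonneg _).trans (hA 0)
  have htail := ((hasSum_nat_add_iff' N).2 hg)
  have hs : Summable fun k : ℕ => A * ((((k + N : ℕ) : ℝ) + 1) * R⁻¹ ^ (k + N)) :=
    ((summable_nat_add_iff N).2 (summable_succ_mul_pow hR0 hR1)).mul_left A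
  refine (htail.norm_le_of_bounded hs.hasSum fun k => ?_).trans ?_
  · rw [norm_mul, norm_pow]
    have h1 := hA (k + N)
    rw [← inv_pow] at h1
    exact (mul_le_of_le_one_right (norm_nonneg _) (pow_le_one₀ (norm_nonneg _) hz)).trans h1
  · rw [tsum_mul_left]
    gcongr
    exact tsum_tail_succ_mul_pow_le hR0 hR1 N

/-- Bernoulli's inequality. This absorbs the factor `N + 1` of the Taylor remainder and accounts for
the second factor `1 + √2` in `gam`. -/
lemma succ_le_one_add_sqrt_two_pow (N : ℕ) : (N : ℝ) + 1 ≤ (1 + √2) ^ N := by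
  have hs1 : 1 ≤ √2 := Real.one_le_sqrt.2 (by norm_num)
  have := one_add_mul_le_pow (show (-2 : ℝ) ≤ √2 by linarith) N
  nlinarith [(Nat.cast_nonneg N : (0 : ℝ) ≤ N)]

variable {d : ℕ} {φ : Fin d → ℂ → ℂ} {T : ℝ → ℝ} {a b : Fin d → ℝ} {r R : ℝ}

/-- The entries of `H_N^{-1} G_N` approximate the Taylor coefficients of the transfer operator
applied to monomials. -/
lemma sum_norm_inv_mul_sub_taylorCoeff_le (hr : 0 < r) (hR : 1 < R)
    (hT : IsAnalyticFullBranchMap T a b) (hφ : HasHolomorphicInverseBranches T a b φ r R)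
    {ρ : ℝ} (hρ : 1 ≤ ρ) (N : ℕ) (l : Fin N) :
    ∑ k : Fin N, ‖((hatH N)⁻¹ * hatG T N) k l
        - taylorCoeff (transfer φ fun z => z ^ (l : ℕ)) k‖ * ρ ^ (k : ℕ)
      ≤ 4 * (d * r / R * geomDerivSum R⁻¹) * (gam * ρ / R) ^ N * r ^ (l : ℕ) := by
  have hR0 : 0 < R := by linarith
  set g := transfer φ fun z => z ^ (l : ℕ) with hg
  set c := taylorCoeff g with hcdef
  have hdiff : DifferentiableOn ℂ g (Metric.ball 0 R) := differentiableOn_transfer hφ (by fun_prop)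
  have hgc : ContinuousOn (fun x : ℝ => g x) (Set.Icc (-1) 1) :=
    hdiff.continuousOn.comp Complex.continuous_ofReal.continuousOn
      fun x hx => ofReal_mem_ball hR hx
  have hSc : Continuous (fun x : ℝ => ∑ j ∈ Finset.range N, c j * (x : ℂ) ^ j) := by fun_prop
  set η : ℝ := d * r / R * r ^ (l : ℕ) * ((N + 1) * R⁻¹ ^ N * geomDerivSum R⁻¹) with hηdef
  have hη : ∀ x ∈ Set.Icc (-1 : ℝ) 1, ‖g x - ∑ j ∈ Finset.range N, c j * (x : ℂ) ^ j‖ ≤ η := by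
    intro x hx
    refine norm_sub_partial_sum_le hR ?_ (fun k => norm_taylorCoeff_transfer_pow_le hφ hR0 l k)
      (hasSum_taylorCoeff hdiff (ofReal_mem_ball hR hx)) N
    rw [Complex.norm_real]
    exact abs_le.2 hx
  have hunit := (Matrix.isUnit_iff_isUnit_det _).1 (isUnit_hatH N)
  -- The column minus the truncated Taylor vector solves the moment system whose right-hand side is
  -- the Taylor remainder.
  have hsys : ∀ k : Fin N,
      (hatH N).mulVec (fun k => ((hatH N)⁻¹ * hatG T N) k l - c k) k
      = (1 / 2 : ℝ) * ∫ x in (-1 : ℝ)..1,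
        (x : ℂ) ^ (k : ℕ) * (g x - ∑ j ∈ Finset.range N, c j * (x : ℂ) ^ j) := by
    intro k
    have h1 : (hatH N).mulVec (fun k => ((hatH N)⁻¹ * hatG T N) k l) k = hatG T N k l := by
      have : hatH N * ((hatH N)⁻¹ * hatG T N) = hatG T N := by
        rw [← mul_assoc, Matrix.mul_nonsing_inv _ hunit, one_mul]
      exact congrFun (congrFun this k) l
    have h2 : (hatH N).mulVec (fun k => c k) k = (1 / 2 : ℝ) * ∫ x in (-1 : ℝ)..1,
        (x : ℂ) ^ (k : ℕ) * ∑ j ∈ Finset.range N, c j * (x : ℂ) ^ j := by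
      simp_rw [Finset.mul_sum]
      rw [Matrix.mulVec, dotProduct, intervalIntegral.integral_finsetSum
        fun m _ => Continuous.intervalIntegrable (by fun_prop) _ _,
        ← Fin.sum_univ_eq_sum_range
          (fun j => ∫ x in (-1 : ℝ)..1, (x : ℂ) ^ (k : ℕ) * (c j * (x : ℂ) ^ j)), Finset.mul_sum]
      refine Finset.sum_congr rfl fun j _ => ?_
      rw [hatH, Matrix.of_apply, Complex.ofReal_mul, mul_assoc,
        ← intervalIntegral.integral_ofReal, ← intervalIntegral.integral_mul_const]
      congr 2
      funext x
      push_cast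
      ring
    have h3 : hatG T N k l = (1 / 2 : ℝ) * ∫ x in (-1 : ℝ)..1, (x : ℂ) ^ (k : ℕ) * g x := by
      rw [hatG, Matrix.of_apply, Complex.ofReal_mul, integral_pow_mul_pow_eq hR hT hφ]
    have h4 : (hatH N).mulVec (fun k => ((hatH N)⁻¹ * hatG T N) k l - c k) k
        = (hatH N).mulVec (fun k => ((hatH N)⁻¹ * hatG T N) k l) k
          - (hatH N).mulVec (fun k => c k) k := by
      rw [← Pi.sub_apply, ← Matrix.mulVec_sub]
      rfl
    rw [h4, h1, h2, h3, ← mul_sub, ← intervalIntegral.integral_sub]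
    · simp_rw [mul_sub]
    · refine ContinuousOn.intervalIntegrable ?_
      rw [Set.uIcc_of_le (by norm_num)]
      exact (Complex.continuous_ofReal.continuousOn.pow _).mul hgc
    · exact Continuous.intervalIntegrable (by fun_prop) _ _
  refine (sum_norm_le_of_hatH_mulVec hρ _ (hgc.sub hSc.continuousOn) hη hsys).trans ?_
  have hK : 0 ≤ geomDerivSum R⁻¹ := geomDerivSum_nonneg (by positivity)
  calc 4 * η * ((1 + √2) * ρ) ^ N
      = 4 * (d * r / R * geomDerivSum R⁻¹) * ((N + 1) * ((1 + √2) * ρ * R⁻¹) ^ N)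
          * r ^ (l : ℕ) := by
        rw [hηdef, mul_pow _ R⁻¹]
        ring
    _ ≤ 4 * (d * r / R * geomDerivSum R⁻¹) * ((1 + √2) ^ N * ((1 + √2) * ρ * R⁻¹) ^ N)
          * r ^ (l : ℕ) := by
        gcongr
        exact succ_le_one_add_sqrt_two_pow N
    _ = _ := by
        rw [← mul_pow, gam]
        ring_nf

end EDMD

/-! ### Operators on `ℓ²` with absolutely summable matrices -/

namespace EDMD

/-- The matrix unit with a single nonzero entry at position `(k, l)`, as an operator. -/
noncomputable def matrixUnit (k l : ℕ) : Ell2 →L[ℂ] Ell2 :=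
  (innerSL ℂ (unit l)).smulRight (unit k)

lemma inner_unit (l : ℕ) (x : Ell2) : inner ℂ (unit l) x = x l := by
  rw [unit, lp.inner_single_left]
  simp

lemma unit_apply (k l : ℕ) : unit k l = if l = k then 1 else 0 := by
  rw [unit, lp.single_apply]
  by_cases h : l = k
  · subst h; simp
  · simp [h]

lemma norm_unit (k : ℕ) : ‖unit k‖ = 1 := by
  rw [unit, lp.norm_single (by norm_num)]
  simp

lemma matrixUnit_apply (k l : ℕ) (x : Ell2) : matrixUnit k l x = x l • unit k := by
  rw [matrixUnit, ContinuousLinearMap.smulRight_apply, innerSL_apply_apply, inner_unit]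

lemma norm_matrixUnit (k l : ℕ) : ‖matrixUnit k l‖ = 1 := by
  rw [matrixUnit, ContinuousLinearMap.norm_smulRight_apply, innerSL_apply_norm, norm_unit,
    norm_unit, one_mul]

/-- The operator with matrix `D`, where `p = (column, row)`. -/
noncomputable def matrixOp (D : ℕ → ℕ → ℂ) : Ell2 →L[ℂ] Ell2 :=
  ∑' p : ℕ × ℕ, D p.2 p.1 • matrixUnit p.2 p.1

lemma summable_norm_prod {D : ℕ → ℕ → ℂ} {β : ℕ → ℝ}
    (hD : ∀ l, Summable fun k => ‖D k l‖) (hβ : Summable β) (h : ∀ l, ∑' k, ‖D k l‖ ≤ β l) :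
    Summable fun p : ℕ × ℕ => ‖D p.2 p.1‖ := by
  rw [summable_prod_of_nonneg fun _ => norm_nonneg _]
  exact ⟨hD, hβ.of_nonneg_of_le (fun l => tsum_nonneg fun k => norm_nonneg _) h⟩

lemma summable_matrixOp {D : ℕ → ℕ → ℂ} (hD : Summable fun p : ℕ × ℕ => ‖D p.2 p.1‖) :
    Summable fun p : ℕ × ℕ => D p.2 p.1 • matrixUnit p.2 p.1 := by
  refine Summable.of_norm (hD.congr fun p => ?_)
  rw [norm_smul, norm_matrixUnit, mul_one]

/-- Matrix units have norm one, so the triangle inequality bounds the operator norm by the sum of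
all moduli, taken column by column. -/
lemma norm_matrixOp_le {D : ℕ → ℕ → ℂ} {β : ℕ → ℝ}
    (hD : ∀ l, Summable fun k => ‖D k l‖) (hβ : Summable β) (h : ∀ l, ∑' k, ‖D k l‖ ≤ β l) :
    ‖matrixOp D‖ ≤ ∑' l, β l := by
  have hs := summable_norm_prod hD hβ h
  have h1 : ‖matrixOp D‖ ≤ ∑' p : ℕ × ℕ, ‖D p.2 p.1‖ :=
    tsum_of_norm_bounded hs.hasSum fun p => by rw [norm_smul, norm_matrixUnit, mul_one]
  refine h1.trans ?_
  rw [hs.tsum_prod' hD]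
  exact Summable.tsum_le_tsum h hs.prod hβ

lemma matrixOp_sub {D E : ℕ → ℕ → ℂ} (hD : Summable fun p : ℕ × ℕ => ‖D p.2 p.1‖)
    (hE : Summable fun p : ℕ × ℕ => ‖E p.2 p.1‖) :
    matrixOp D - matrixOp E = matrixOp fun k l => D k l - E k l := by
  rw [matrixOp, matrixOp, ← (summable_matrixOp hD).tsum_sub (summable_matrixOp hE)]
  simp_rw [matrixOp, sub_smul]

lemma matrixOp_unit_apply {D : ℕ → ℕ → ℂ} (hD : Summable fun p : ℕ × ℕ => ‖D p.2 p.1‖)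
    (k l : ℕ) : matrixOp D (unit l) k = D k l := by
  have h := ((innerSL ℂ (unit k)).comp
    (ContinuousLinearMap.apply ℂ Ell2 (unit l))).hasSum (summable_matrixOp hD).hasSum
  have h2 : HasSum (fun p : ℕ × ℕ => D p.2 p.1 * (unit l p.1 * unit p.2 k))
      (matrixOp D (unit l) k) := by
    rw [← inner_unit k]
    refine h.congr_fun fun p => ?_
    simp [matrixUnit_apply, inner_unit]
  refine h2.unique ?_
  have h3 : (fun p : ℕ × ℕ => D p.2 p.1 * (unit l p.1 * unit p.2 k))
      = fun p => if p = (l, k) then D k l else 0 := by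
    funext p
    obtain ⟨p1, p2⟩ := p
    simp only [unit_apply, Prod.mk.injEq]
    by_cases h1 : p1 = l
    · by_cases h4 : k = p2
      · subst h1 h4; simp
      · simp [h4, Ne.symm h4]
    · simp [h1]
  rw [h3]
  exact hasSum_ite_eq _ _

lemma lift_eq_sum {N : ℕ} (A : Matrix (Fin N) (Fin N) ℂ) :
    lift A = ∑ k : Fin N, ∑ l : Fin N, A k l • matrixUnit k l := rfl

lemma matrixUnit_comp (k l m n : ℕ) :
    matrixUnit k l ∘L matrixUnit m n = if l = m then matrixUnit k n else 0 := by
  ext1 x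
  rw [ContinuousLinearMap.comp_apply, matrixUnit_apply, matrixUnit_apply, lp.coeFn_smul,
    Pi.smul_apply, unit_apply]
  split_ifs <;> simp [matrixUnit_apply]

lemma lift_comp {N : ℕ} (A B : Matrix (Fin N) (Fin N) ℂ) : lift A ∘L lift B = lift (A * B) := by
  have hcomp : ∀ k l m n : Fin N, (A k l • matrixUnit k l) ∘L (B m n • matrixUnit m n)
      = if l = m then (A k l * B m n) • matrixUnit k n else 0 := by
    intro k l m n
    rw [ContinuousLinearMap.smul_comp, ContinuousLinearMap.comp_smul, matrixUnit_comp, smul_smul]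
    simp only [Fin.val_inj]
    split_ifs <;> simp
  simp only [lift_eq_sum, ContinuousLinearMap.finsetSum_comp, ContinuousLinearMap.comp_finsetSum,
    hcomp, Matrix.mul_apply, Finset.sum_smul]
  simp only [Finset.sum_ite_eq', Finset.mem_univ, if_true]
  rw [Finset.sum_comm, Finset.sum_comm (t := Finset.univ) (s := Finset.univ)
    (f := fun k n => ∑ m, (A k m * B m n) • matrixUnit k n)]
  exact Finset.sum_congr rfl fun n _ => Finset.sum_comm

/-- Extension of a finite matrix by zero. -/
noncomputable def extendMatrix {N : ℕ} (A : Matrix (Fin N) (Fin N) ℂ) (k l : ℕ) : ℂ :=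
  if h : k < N ∧ l < N then A ⟨k, h.1⟩ ⟨l, h.2⟩ else 0

lemma extendMatrix_val {N : ℕ} (A : Matrix (Fin N) (Fin N) ℂ) (k l : Fin N) :
    extendMatrix A k l = A k l := by
  simp [extendMatrix]

lemma extendMatrix_eq_zero {N : ℕ} (A : Matrix (Fin N) (Fin N) ℂ) {k l : ℕ}
    (h : ¬ (k < N ∧ l < N)) : extendMatrix A k l = 0 := dif_neg h

lemma extendMatrix_eq_zero_of_notMem {N : ℕ} (A : Matrix (Fin N) (Fin N) ℂ) {p : ℕ × ℕ}
    (h : p ∉ Finset.range N ×ˢ Finset.range N) : extendMatrix A p.2 p.1 = 0 := by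
  refine extendMatrix_eq_zero A fun hp => h ?_
  simp [hp.1, hp.2]

lemma summable_extendMatrix {N : ℕ} (A : Matrix (Fin N) (Fin N) ℂ) :
    Summable fun p : ℕ × ℕ => ‖extendMatrix A p.2 p.1‖ :=
  summable_of_ne_finset_zero (s := Finset.range N ×ˢ Finset.range N)
    fun p hp => by rw [extendMatrix_eq_zero_of_notMem A hp, norm_zero]

lemma lift_eq_matrixOp {N : ℕ} (A : Matrix (Fin N) (Fin N) ℂ) :
    lift A = matrixOp (extendMatrix A) := by
  rw [matrixOp, tsum_eq_sum (s := Finset.range N ×ˢ Finset.range N)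
    fun p hp => by rw [extendMatrix_eq_zero_of_notMem A hp, zero_smul],
    Finset.sum_product, lift_eq_sum, Finset.sum_comm,
    ← Fin.sum_univ_eq_sum_range
      (fun l => ∑ k ∈ Finset.range N, extendMatrix A k l • matrixUnit k l)]
  refine Finset.sum_congr rfl fun l _ => ?_
  rw [← Fin.sum_univ_eq_sum_range (fun k => extendMatrix A k l • matrixUnit k l)]
  simp_rw [extendMatrix_val]

lemma galerkin_eq_lift (T : ℝ → ℝ) (ρ : ℝ) (N : ℕ) :
    galerkin T ρ N = lift (Matrix.of fun k l : Fin N =>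
      (ρ : ℂ) ^ (k : ℕ) * ((hatH N)⁻¹ * hatG T N) k l * ((ρ : ℂ) ^ (l : ℕ))⁻¹) := by
  rw [galerkin, opV, opHDagger, opG, opVInv, lift_comp, lift_comp, lift_comp]
  congr 1
  ext k l
  rw [← mul_assoc, ← mul_assoc, mul_assoc (Matrix.diagonal _), Matrix.mul_diagonal,
    Matrix.diagonal_mul, Matrix.of_apply]

/-! ### The transfer matrix and the total error -/

variable {d : ℕ} {φ : Fin d → ℂ → ℂ} {T : ℝ → ℝ} {a b : Fin d → ℝ} {r R : ℝ}

/-- The matrix of the transfer operator in the standard basis of the Hardy space. -/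
noncomputable def transferEntry (φ : Fin d → ℂ → ℂ) (ρ : ℝ) (k l : ℕ) : ℂ :=
  ((ρ : ℂ) ^ l)⁻¹ * ((ρ : ℂ) ^ k * taylorCoeff (transfer φ fun z => z ^ l) k)

lemma norm_transferEntry_le (hR : 0 < R)
    (hφ : HasHolomorphicInverseBranches T a b φ r R) {ρ : ℝ} (hρ : 0 < ρ) (k l : ℕ) :
    ‖transferEntry φ ρ k l‖ ≤ d * r / R * (r / ρ) ^ l * ((k + 1) * (ρ / R) ^ k) := by
  have h := norm_taylorCoeff_transfer_pow_le hφ hR l k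
  rw [transferEntry, norm_mul, norm_mul, norm_inv, norm_pow, norm_pow, Complex.norm_real,
    Real.norm_of_nonneg hρ.le]
  calc _ ≤ (ρ ^ l)⁻¹ * (ρ ^ k * (d * r / R * r ^ l * ((k + 1) * (R ^ k)⁻¹))) := by gcongr
    _ = _ := by
      rw [div_pow, div_pow]
      field_simp

lemma summable_norm_transferEntry (hR : 0 < R)
    (hφ : HasHolomorphicInverseBranches T a b φ r R) {ρ : ℝ} (hρ : 0 < ρ) (hρR : ρ < R) (l : ℕ) :
    Summable fun k => ‖transferEntry φ ρ k l‖ :=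
  ((summable_succ_mul_pow (div_nonneg hρ.le hR.le) ((div_lt_one hR).2 hρR)).mul_left
    _).of_nonneg_of_le (fun _ => norm_nonneg _) fun k => norm_transferEntry_le hR hφ hρ k l

lemma tsum_norm_transferEntry_tail_le (hr : 0 < r) (hR : 0 < R)
    (hφ : HasHolomorphicInverseBranches T a b φ r R) {ρ : ℝ} (hρ : 0 < ρ) (hρR : ρ < R)
    (N l : ℕ) :
    ∑' k, ‖transferEntry φ ρ (k + N) l‖
      ≤ d * r / R * geomDerivSum (ρ / R) * ((N + 1) * (ρ / R) ^ N) * (r / ρ) ^ l := by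
  have hx0 : 0 ≤ ρ / R := by positivity
  have hx1 : ρ / R < 1 := (div_lt_one hR).2 hρR
  calc _ ≤ ∑' k : ℕ, d * r / R * (r / ρ) ^ l * ((((k + N : ℕ) : ℝ) + 1) * (ρ / R) ^ (k + N)) :=
        Summable.tsum_le_tsum (fun k => norm_transferEntry_le hR hφ hρ (k + N) l)
          ((summable_nat_add_iff N).2 (summable_norm_transferEntry hR hφ hρ hρR l))
          (((summable_nat_add_iff N).2 (summable_succ_mul_pow hx0 hx1)).mul_left _)
    _ ≤ d * r / R * (r / ρ) ^ l * ((N + 1) * (ρ / R) ^ N * geomDerivSum (ρ / R)) := by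
        rw [tsum_mul_left]
        gcongr
        exact tsum_tail_succ_mul_pow_le hx0 hx1 N
    _ = _ := by ring

lemma summable_prod_transferEntry (hr : 0 < r) (hR : 0 < R)
    (hφ : HasHolomorphicInverseBranches T a b φ r R) {ρ : ℝ} (hrρ : r < ρ) (hρR : ρ < R) :
    Summable fun p : ℕ × ℕ => ‖transferEntry φ ρ p.2 p.1‖ := by
  have hρ : 0 < ρ := hr.trans hrρ
  refine summable_norm_prod (summable_norm_transferEntry hR hφ hρ hρR)
    ((summable_geometric_of_lt_one (div_nonneg hr.le hρ.le) ((div_lt_one hρ).2 hrρ)).mul_left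
      (d * r / R * geomDerivSum (ρ / R))) fun l => ?_
  simpa using tsum_norm_transferEntry_tail_le hr hR hφ hρ hρR 0 l

lemma isTransferMatrix_matrixOp (hr : 0 < r) (hR : 0 < R)
    (hφ : HasHolomorphicInverseBranches T a b φ r R) {ρ : ℝ} (hrρ : r < ρ) (hρR : ρ < R) :
    IsTransferMatrix φ ρ (matrixOp (transferEntry φ ρ)) := by
  intro k l
  rw [matrixOp_unit_apply (summable_prod_transferEntry hr hR hφ hrρ hρR)]
  exact isTransferMatrix_entry hφ (hr.trans hrρ) hρR k l

lemma one_le_gam : 1 ≤ gam := by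
  have : 0 ≤ √2 := Real.sqrt_nonneg 2
  rw [gam]
  nlinarith

lemma succ_le_gam_pow (N : ℕ) : (N : ℝ) + 1 ≤ gam ^ N := by
  refine (succ_le_one_add_sqrt_two_pow N).trans (pow_le_pow_left₀ (by positivity) ?_ N)
  have : 0 ≤ √2 := Real.sqrt_nonneg 2
  rw [gam]
  nlinarith

/-- The error bound for the Galerkin matrices. -/
lemma exists_norm_galerkin_sub_le (hr : 1 < r) (hrR : r < R)
    (hT : IsAnalyticFullBranchMap T a b) (hφ : HasHolomorphicInverseBranches T a b φ r R)
    {ρ : ℝ} (hrρ : r < ρ) (hρR : ρ < R) :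
    ∃ C : ℝ, 0 < C ∧ ∀ N : ℕ, ‖galerkin T ρ N - matrixOp (transferEntry φ ρ)‖
      ≤ C * ((gam * ρ / R) ^ N + (r / ρ) ^ N) := by
  have hr0 : 0 < r := by linarith
  have hR0 : 0 < R := by linarith
  have hρ : 0 < ρ := by linarith
  have hq0 : 0 ≤ r / ρ := by positivity
  have hq1 : r / ρ < 1 := (div_lt_one hρ).2 hrρ
  have hK1 : 0 ≤ geomDerivSum R⁻¹ := geomDerivSum_nonneg (by positivity)
  have hK2 : 0 ≤ geomDerivSum (ρ / R) := geomDerivSum_nonneg (by positivity)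
  set A1 : ℝ := 4 * (d * r / R * geomDerivSum R⁻¹) with hA1
  set A2 : ℝ := d * r / R * geomDerivSum (ρ / R) with hA2
  have hA1' : 0 ≤ A1 := by positivity
  have hA2' : 0 ≤ A2 := by positivity
  have hgeom := hasSum_geometric_of_lt_one hq0 hq1
  have hq' : 0 < 1 - r / ρ := by linarith
  -- `A1` comes from the block and `A2` from the entries of `L` outside it; the `1` makes the
  -- constant positive, and the last factor sums the geometric series over columns.
  refine ⟨(A1 + A2 + 1) * (1 - r / ρ)⁻¹, by positivity, fun N => ?_⟩
  have hgam := one_le_gam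
  set ε : ℝ := (gam * ρ / R) ^ N with hε
  have hε0 : 0 ≤ ε := by positivity
  set B := Matrix.of fun k l : Fin N =>
      (ρ : ℂ) ^ (k : ℕ) * ((hatH N)⁻¹ * hatG T N) k l * ((ρ : ℂ) ^ (l : ℕ))⁻¹ with hB
  set D : ℕ → ℕ → ℂ := fun k l => extendMatrix B k l - transferEntry φ ρ k l with hD
  have hsumL := summable_norm_transferEntry hR0 hφ hρ hρR
  have hsumP := summable_prod_transferEntry hr0 hR0 hφ hrρ hρR
  rw [galerkin_eq_lift, lift_eq_matrixOp, matrixOp_sub (summable_extendMatrix B) hsumP]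
  have hDtail : ∀ l k, D (k + N) l = - transferEntry φ ρ (k + N) l := fun l k => by
    rw [hD]
    simp only
    rw [extendMatrix_eq_zero B (by omega), zero_sub]
  have hDs : ∀ l, Summable fun k => ‖D k l‖ := fun l => by
    rw [← summable_nat_add_iff N]
    simp_rw [hDtail, norm_neg]
    exact (summable_nat_add_iff N).2 (hsumL l)
  -- For `l < N` the column error is the block error plus the rows `k ≥ N`; for `l ≥ N` the Galerkin
  -- column vanishes and a full column of `L` remains. The first term is kept for every `l` so that
  -- it sums in closed form.
  set β : ℕ → ℝ := fun l => (A1 + A2) * ε * (r / ρ) ^ l + if l < N then 0 else A2 * (r / ρ) ^ l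
    with hβ
  have hβsum : HasSum β ((A1 + A2) * ε * (1 - r / ρ)⁻¹ + A2 * ((r / ρ) ^ N * (1 - r / ρ)⁻¹)) := by
    refine (hgeom.mul_left _).add ?_
    rw [← hasSum_nat_add_iff' N]
    have h0 : ∑ l ∈ Finset.range N, (if l < N then 0 else A2 * (r / ρ) ^ l) = 0 :=
      Finset.sum_eq_zero fun l hl => if_pos (Finset.mem_range.1 hl)
    rw [h0, sub_zero]
    refine ((hgeom.mul_left ((r / ρ) ^ N)).mul_left A2).congr_fun fun l => ?_
    rw [if_neg (by omega), pow_add]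
    ring
  refine (norm_matrixOp_le hDs hβsum.summable fun l => ?_).trans ?_
  · by_cases hl : l < N
    · simp only [hβ, if_pos hl, add_zero]
      rw [← (hDs l).sum_add_tsum_nat_add N, add_mul, add_mul]
      refine add_le_add ?_ ?_
      · rw [← Fin.sum_univ_eq_sum_range (fun k => ‖D k l‖)]
        have hmain := sum_norm_inv_mul_sub_taylorCoeff_le hr0 (hr.trans hrR) hT hφ
          (hr.trans hrρ).le N ⟨l, hl⟩
        have heq : ∀ k : Fin N, ‖D k l‖ = (ρ ^ l)⁻¹ * (‖((hatH N)⁻¹ * hatG T N) k ⟨l, hl⟩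
            - taylorCoeff (transfer φ fun z => z ^ l) k‖ * ρ ^ (k : ℕ)) := by
          intro k
          have h1 : D k l = ((ρ : ℂ) ^ l)⁻¹ * ((((hatH N)⁻¹ * hatG T N) k ⟨l, hl⟩
            - taylorCoeff (transfer φ fun z => z ^ l) k) * (ρ : ℂ) ^ (k : ℕ)) := by
            have := extendMatrix_val B k ⟨l, hl⟩
            simp only at this
            rw [hD]
            simp only
            rw [this, hB, Matrix.of_apply, transferEntry]
            ring
          rw [h1, norm_mul, norm_mul, norm_inv, norm_pow, norm_pow, Complex.norm_real,
            Real.norm_of_nonneg hρ.le]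
        simp_rw [heq]
        rw [← Finset.mul_sum]
        calc _ ≤ (ρ ^ l)⁻¹ * (A1 * ε * r ^ l) := by gcongr
          _ = _ := by rw [div_pow]; ring
      · simp_rw [hDtail, norm_neg]
        refine (tsum_norm_transferEntry_tail_le hr0 hR0 hφ hρ hρR N l).trans ?_
        gcongr
        -- The rows below the block decay like `(N+1)(ρ/R)^N`, and `γ^N` leaves room for `N + 1`.
        calc ((N : ℝ) + 1) * (ρ / R) ^ N ≤ gam ^ N * (ρ / R) ^ N := by
              gcongr
              exact succ_le_gam_pow N
          _ = ε := by rw [hε, ← mul_pow, mul_div_assoc]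
    · simp only [hβ, if_neg hl]
      have hDl : ∀ k, D k l = - transferEntry φ ρ k l := fun k => by
        rw [hD]
        simp only
        rw [extendMatrix_eq_zero B (by omega), zero_sub]
      simp_rw [hDl, norm_neg]
      have h := tsum_norm_transferEntry_tail_le hr0 hR0 hφ hρ hρR 0 l
      simp only [add_zero, Nat.cast_zero, zero_add, pow_zero, mul_one] at h
      exact h.trans (le_add_of_nonneg_left (by positivity))
  · rw [hβsum.tsum_eq]
    have h1 : 0 ≤ (1 - r / ρ)⁻¹ := by positivity
    have h2 : 0 ≤ (r / ρ) ^ N := by positivity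
    have h3 : 0 ≤ (1 - r / ρ)⁻¹ * ε := by positivity
    have h4 : 0 ≤ (1 - r / ρ)⁻¹ * (r / ρ) ^ N := by positivity
    nlinarith [mul_nonneg hA1' h4]

end EDMD

/-! ### The optimal radius -/

namespace EDMD

variable {r R : ℝ}

lemma gam_pos : 0 < gam := one_pos.trans_le one_le_gam

lemma rhoOpt_pos (hr : 0 < r) (hR : 0 < R) : 0 < rhoOpt r R :=
  Real.sqrt_pos.2 (div_pos (mul_pos hr hR) gam_pos)

lemma rhoOpt_sq (hr : 0 < r) (hR : 0 < R) : gam * rhoOpt r R ^ 2 = r * R := by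
  have := gam_pos
  rw [rhoOpt, Real.sq_sqrt (by positivity)]
  field_simp

/-- `√(rR/γ)` is the radius at which the two rates balance, by `γρ² = rR`. -/
lemma div_rhoOpt_eq (hr : 0 < r) (hR : 0 < R) : r / rhoOpt r R = gam * rhoOpt r R / R := by
  have h := rhoOpt_pos hr hR
  have h2 := rhoOpt_sq hr hR
  rw [div_eq_div_iff h.ne' hR.ne']
  linarith

lemma gam_mul_rhoOpt_div_eq (hr : 0 < r) (hR : 0 < R) :
    gam * rhoOpt r R / R = √(gam * r / R) := by
  have h := rhoOpt_pos hr hR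
  have hg := gam_pos
  symm
  rw [Real.sqrt_eq_iff_mul_self_eq (by positivity) (by positivity)]
  have h2 := rhoOpt_sq hr hR
  field_simp
  linarith

lemma bound_rhoOpt_eq (hr : 0 < r) (hR : 0 < R) (N : ℕ) :
    (gam * rhoOpt r R / R) ^ N + (r / rhoOpt r R) ^ N = 2 * (gam * r / R) ^ ((N : ℝ) / 2) := by
  have hg := gam_pos
  rw [div_rhoOpt_eq hr hR, gam_mul_rhoOpt_div_eq hr hR, ← two_mul, Real.sqrt_eq_rpow,
    ← Real.rpow_natCast, ← Real.rpow_mul (by positivity)]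
  congr 2
  ring

/-- The product of the two terms is `(γr/R)^N` for every `ρ`, so their sum is at least twice its
square root, with equality when the terms agree. -/
lemma bound_rhoOpt_le (hr : 0 < r) (hR : 0 < R) (N : ℕ) {ρ : ℝ} (hρ : 0 < ρ) :
    (gam * rhoOpt r R / R) ^ N + (r / rhoOpt r R) ^ N ≤ (gam * ρ / R) ^ N + (r / ρ) ^ N := by
  have hg := gam_pos
  have h0 := rhoOpt_pos hr hR
  rw [div_rhoOpt_eq hr hR, gam_mul_rhoOpt_div_eq hr hR]
  have hprod : (gam * ρ / R) ^ N * (r / ρ) ^ N = (√(gam * r / R) ^ N) ^ 2 := by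
    rw [← mul_pow, ← pow_mul, mul_comm N 2, pow_mul, Real.sq_sqrt (by positivity)]
    congr 1
    field_simp
  have hx : 0 ≤ (gam * ρ / R) ^ N := by positivity
  have hy : 0 ≤ (r / ρ) ^ N := by positivity
  have hs : 0 ≤ √(gam * r / R) ^ N := by positivity
  refine abs_le_of_sq_le_sq' ?_ (by positivity) |>.2
  nlinarith [sq_nonneg ((gam * ρ / R) ^ N - (r / ρ) ^ N)]

lemma lt_rhoOpt (hr : 0 < r) (h : gam * r < R) : r < rhoOpt r R := by
  have hg := gam_pos
  refine Real.lt_sqrt_of_sq_lt ?_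
  rw [lt_div_iff₀ hg]
  nlinarith

lemma rhoOpt_lt (hR : 0 < R) (hrR : r < R) : rhoOpt r R < R := by
  have hg := one_le_gam
  refine (Real.sqrt_lt' hR).2 ?_
  rw [div_lt_iff₀ (by linarith)]
  nlinarith [mul_pos hR hR]

end EDMD

theorem proposition11 {d : ℕ} (T : ℝ → ℝ) (a b : Fin d → ℝ) (φ : Fin d → ℂ → ℂ) (r R : ℝ)
    (hr : 1 < r) (hrR : r < R)
    (hT : EDMD.IsAnalyticFullBranchMap T a b)
    (hφ : EDMD.HasHolomorphicInverseBranches T a b φ r R) :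
    -- the matrices whose inverses are used are invertible
    (∀ N : ℕ, IsUnit (EDMD.hatH N)) ∧
    -- the error bound, for every radius between r and R
    (∀ ρ : ℝ, r < ρ → ρ < R →
      ∃ L : EDMD.Ell2 →L[ℂ] EDMD.Ell2, EDMD.IsTransferMatrix φ ρ L ∧
        ∃ C : ℝ, 0 < C ∧ ∀ N : ℕ,
          ‖EDMD.galerkin T ρ N - L‖ ≤ C * ((EDMD.gam * ρ / R) ^ N + (r / ρ) ^ N)) ∧
    -- the choice of the radius √(rR/γ) minimises the bound
    (∀ N : ℕ,
      (EDMD.gam * EDMD.rhoOpt r R / R) ^ N + (r / EDMD.rhoOpt r R) ^ N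
          = 2 * (EDMD.gam * r / R) ^ ((N : ℝ) / 2) ∧
      ∀ ρ : ℝ, 0 < ρ →
        (EDMD.gam * EDMD.rhoOpt r R / R) ^ N + (r / EDMD.rhoOpt r R) ^ N
          ≤ (EDMD.gam * ρ / R) ^ N + (r / ρ) ^ N) ∧
    -- it is admissible, and gives the stated rate, if r/R < 1/γ
    (EDMD.gam * r < R →
      r < EDMD.rhoOpt r R ∧ EDMD.rhoOpt r R < R ∧
      ∃ L : EDMD.Ell2 →L[ℂ] EDMD.Ell2, EDMD.IsTransferMatrix φ (EDMD.rhoOpt r R) L ∧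
        ∃ C : ℝ, 0 < C ∧ ∀ N : ℕ,
          ‖EDMD.galerkin T (EDMD.rhoOpt r R) N - L‖
            ≤ C * (EDMD.gam * r / R) ^ ((N : ℝ) / 2)) := by
  have hr0 : 0 < r := by linarith
  have hR0 : 0 < R := by linarith
  refine ⟨EDMD.isUnit_hatH, fun ρ hrρ hρR => ?_, fun N => ⟨EDMD.bound_rhoOpt_eq hr0 hR0 N,
    fun ρ hρ => EDMD.bound_rhoOpt_le hr0 hR0 N hρ⟩, fun h => ?_⟩
  · exact ⟨_, EDMD.isTransferMatrix_matrixOp hr0 hR0 hφ hrρ hρR,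
      EDMD.exists_norm_galerkin_sub_le hr hrR hT hφ hrρ hρR⟩
  · have h1 := EDMD.lt_rhoOpt hr0 h
    have h2 := EDMD.rhoOpt_lt hR0 hrR
    obtain ⟨C, hC, hbound⟩ := EDMD.exists_norm_galerkin_sub_le hr hrR hT hφ h1 h2
    -- The factor `2` is that of the minimal value `2(γr/R)^(N/2)`.
    refine ⟨h1, h2, _, EDMD.isTransferMatrix_matrixOp hr0 hR0 hφ h1 h2, C * 2, by positivity,
      fun N => (hbound N).trans (le_of_eq ?_)⟩
    rw [EDMD.bound_rhoOpt_eq hr0 hR0, mul_assoc]
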